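/- **Setting.** A local system is a finite-dimensional Hilbert space with an orthonormal basis of eigenvectors of a particle number operator with eigenvalues in $\{0,1,2,\dots\}$; particle numbers add up under tensor products. A pure state shared by Alice and Bob is a unit vector that is an eigenvector of the total particle number $\hat N_A+\hat N_B$ (superselection rule, SSR). An SSR-LOCC protocol consists of finitely many rounds; in each round one party performs a local measurement with finitely many Kraus operators $K_i$, $\sum_i K_i^\dagger K_i=1$, where each $K_i$ changes the local particle number by a fixed integer $\Delta_i$ (so local ancillas of definite particle number may be added, and local subsystems discarded), and announces the outcome, on which all later rounds may depend; at the end the outcomes are forgotten. Write $\chi\xrightarrow{\ \varepsilon\ }\psi$ if some SSR-LOCC protocol maps $|\chi\rangle\langle\chi|$ to a state $\rho$ with $\langle\psi|\rho|\psi\rangle\ge 1-\varepsilon$. For a pure bipartite state $\psi$ let $E(\psi)$ be the entropy of entanglement (the von Neumann entropy, with logarithm to base $2$, of Alice's reduced state), and let $V(\psi)=4\left(\langle\psi|\hat N_A^2|\psi\rangle-\langle\psi|\hat N_A|\psi\rangle^2\right)$ be the superselection induced variance. A qubit is a local system with basis $|0\rangle,|1\rangle$ of zero and one particle. Let $$|\text{V-EPR}\rangle=\tfrac1{\sqrt2}\left(|0\rangle_A|1\rangle_B+|1\rangle_A|0\rangle_B\right),\qquad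 |\text{E-EPR}\rangle=\tfrac1{\sqrt2}\left(|01\rangle_A|10\rangle_B+|10\rangle_A|01\rangle_B\right).$$ **Corollary.** Let $\phi$ be a pure state (compatible with the SSR) of two qubits, one held by Alice and one by Bob. Then $E(\phi)\ge V(\phi)$, and asymptotically $$|\phi\rangle\longleftrightarrow|\text{E-EPR}\rangle^{\otimes[E(\phi)-V(\phi)]}\otimes|\text{V-EPR}\rangle^{\otimes V(\phi)}$$ in the following sense: for all $\delta,\varepsilon>0$ there is $N_0$ such that for all $N\ge N_0$ $$|\phi\rangle^{\otimes N}\xrightarrow{\ \varepsilon\ }|\text{E-EPR}\rangle^{\otimes e_N^-}\otimes|\text{V-EPR}\rangle^{\otimes v_N}\qquad\text{and}\qquad|\text{E-EPR}\rangle^{\otimes e_N^+}\otimes|\text{V-EPR}\rangle^{\otimes v_N}\xrightarrow{\ \varepsilon\ }|\phi\rangle^{\otimes N},$$ where $v_N=\lfloor N\,V(\phi)\rfloor$, $e_N^-=\max\{0,\lfloor N(E(\phi)-V(\phi)-\delta)\rfloor\}$ and $e_N^+=\lceil N(E(\phi)-V(\phi)+\delta)\rceil$. -/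

import Mathlib

open scoped Matrix Kronecker

noncomputable section

namespace SSR

/-- A finite-dimensional local quantum system with a particle number: an orthonormal basis `ι` of
eigenvectors of the particle number operator, `num i` being the number of particles in `i`. -/
structure LocalSystem where
  ι : Type
  [fin : Fintype ι]
  [dec : DecidableEq ι]
  num : ι → ℕ

attribute [instance] LocalSystem.fin LocalSystem.dec

/-- Composition of two local systems held by the same party; particle numbers add up. -/
abbrev LocalSystem.tensor (A B : LocalSystem) : LocalSystem where
  ι := A.ι × B.ι
  num x := A.num x.1 + B.num x.2

/-- `N` copies of a local system. -/
abbrev LocalSystem.pow (A : LocalSystem) (N : ℕ) : LocalSystem where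
  ι := Fin N → A.ι
  num x := ∑ k, A.num (x k)

/-- A single mode with basis `|0⟩`, `|1⟩` of zero and one particle. -/
abbrev qubit : LocalSystem where
  ι := Fin 2
  num i := (i : ℕ)

/-- Vectors of the bipartite space `H_A ⊗ H_B`. -/
abbrev Ket (A B : LocalSystem) : Type := A.ι × B.ι → ℂ

/-- Operators from `H_A ⊗ H_B` to itself. -/
abbrev Op (A B : LocalSystem) : Type := Matrix (A.ι × B.ι) (A.ι × B.ι) ℂ

/-- A pure state compatible with the superselection rule: a unit vector that is an eigenvector of
the total particle number. -/
def IsPureState {A B : LocalSystem} (ψ : Ket A B) : Prop :=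
  ∑ x, ‖ψ x‖ ^ 2 = 1 ∧ ∃ n : ℕ, ∀ a b, ψ (a, b) ≠ 0 → A.num a + B.num b = n

/-- The tensor product of two bipartite vectors, as a bipartite vector `A₁A₂ : B₁B₂`. -/
def Ket.tensor {A₁ B₁ A₂ B₂ : LocalSystem} (ψ₁ : Ket A₁ B₁) (ψ₂ : Ket A₂ B₂) :
    Ket (A₁.tensor A₂) (B₁.tensor B₂) :=
  fun x => ψ₁ (x.1.1, x.2.1) * ψ₂ (x.1.2, x.2.2)

/-- `N` copies of a bipartite vector. -/
def Ket.pow {A B : LocalSystem} (ψ : Ket A B) (N : ℕ) : Ket (A.pow N) (B.pow N) :=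
  fun x => ∏ k, ψ (x.1 k, x.2 k)

/-- `(|0⟩_A |1⟩_B + |1⟩_A |0⟩_B) / √2`. -/
def vEPR : Ket qubit qubit := fun x =>
  if x = (0, 1) ∨ x = (1, 0) then ((Real.sqrt 2 : ℝ) : ℂ)⁻¹ else 0

/-- `(|01⟩_A |10⟩_B + |10⟩_A |01⟩_B) / √2`, each party holding two modes. -/
def eEPR : Ket (qubit.tensor qubit) (qubit.tensor qubit) := fun x =>
  if x = ((0, 1), (1, 0)) ∨ x = ((1, 0), (0, 1)) then ((Real.sqrt 2 : ℝ) : ℂ)⁻¹ else 0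

/-- The rank one operator `|ψ⟩⟨ψ|`. -/
def Ket.proj {A B : LocalSystem} (ψ : Ket A B) : Op A B := Matrix.vecMulVec ψ (star ψ)

/-- `⟨ψ| O |ψ⟩` (its real part, which is all of it for Hermitian `O`). -/
def Ket.expect {A B : LocalSystem} (ψ : Ket A B) (O : Op A B) : ℝ := (star ψ ⬝ᵥ (O *ᵥ ψ)).re

/-- Alice's reduced density operator `tr_B |ψ⟩⟨ψ|`. -/
def Ket.reducedA {A B : LocalSystem} (ψ : Ket A B) : Matrix A.ι A.ι ℂ :=
  Matrix.of fun a a' => ∑ b, ψ.proj (a, b) (a', b)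

theorem Ket.reducedA_isHermitian {A B : LocalSystem} (ψ : Ket A B) : ψ.reducedA.IsHermitian := by
  ext a a'
  simp [Ket.reducedA, Ket.proj, Matrix.vecMulVec_apply, mul_comm]

/-- Entropy of entanglement: the von Neumann entropy, in bits, of Alice's reduced state. -/
def Ket.entanglement {A B : LocalSystem} (ψ : Ket A B) : ℝ :=
  (∑ a, Real.negMulLog (ψ.reducedA_isHermitian.eigenvalues a)) / Real.log 2

/-- Alice's particle number operator `N_A ⊗ 1`. -/
def numA (A B : LocalSystem) : Op A B :=
  Matrix.diagonal (fun a => (A.num a : ℂ)) ⊗ₖ (1 : Matrix B.ι B.ι ℂ)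

/-- Superselection induced variance `4 (⟨N_A²⟩ - ⟨N_A⟩²)`. -/
def Ket.siv {A B : LocalSystem} (ψ : Ket A B) : ℝ :=
  4 * (ψ.expect (numA A B * numA A B) - ψ.expect (numA A B) ^ 2)

/-- A local generalized measurement allowed by the superselection rule (with ancillas): the Kraus
operators are complete and each of them shifts the local particle number by a fixed amount `Δ`,
which may depend on the outcome. The system after the measurement may depend on the outcome;
appending or discarding local subsystems is included. -/
def IsMeasurement {A : LocalSystem} {r : ℕ} {C : Fin r → LocalSystem}
    (K : (i : Fin r) → Matrix (C i).ι A.ι ℂ) : Prop :=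
  ∑ i, (K i)ᴴ * K i = 1 ∧
    ∀ i, ∃ Δ : ℤ, ∀ c a, K i c a ≠ 0 → ((C i).num c : ℤ) = (A.num a : ℤ) + Δ

/-- `SSRLOCC A' B' A B Λ`: the map `Λ` from operators on `A : B` to operators on `A' : B'` is
carried out by a finite protocol of local measurements allowed by the superselection rule and
classical communication: in each round one party measures and announces the outcome `i`, on which
all that follows (`Λ i`) may depend. In the end the outcomes are forgotten. -/
inductive SSRLOCC (A' B' : LocalSystem) :
    (A B : LocalSystem) → (Op A B → Op A' B') → Prop
  | done : SSRLOCC A' B' A' B' (fun ρ => ρ)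
  | alice {A B : LocalSystem} {r : ℕ} {C : Fin r → LocalSystem}
      (K : (i : Fin r) → Matrix (C i).ι A.ι ℂ) (hK : IsMeasurement K)
      (Λ : (i : Fin r) → Op (C i) B → Op A' B')
      (hΛ : ∀ i, SSRLOCC A' B' (C i) B (Λ i)) :
      SSRLOCC A' B' A B (fun ρ => ∑ i, Λ i
        ((K i ⊗ₖ (1 : Matrix B.ι B.ι ℂ)) * ρ * (K i ⊗ₖ (1 : Matrix B.ι B.ι ℂ))ᴴ))
  | bob {A B : LocalSystem} {r : ℕ} {C : Fin r → LocalSystem}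
      (K : (i : Fin r) → Matrix (C i).ι B.ι ℂ) (hK : IsMeasurement K)
      (Λ : (i : Fin r) → Op A (C i) → Op A' B')
      (hΛ : ∀ i, SSRLOCC A' B' A (C i) (Λ i)) :
      SSRLOCC A' B' A B (fun ρ => ∑ i, Λ i
        (((1 : Matrix A.ι A.ι ℂ) ⊗ₖ K i) * ρ * ((1 : Matrix A.ι A.ι ℂ) ⊗ₖ K i)ᴴ))

/-- Some SSR-LOCC protocol turns `φ` into a state whose fidelity `⟨ψ|ρ|ψ⟩` with `ψ` is at least
`1 - ε`. -/
def Converts {A B A' B' : LocalSystem} (φ : Ket A B) (ψ : Ket A' B') (ε : ℝ) : Prop :=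
  ∃ Λ : Op A B → Op A' B', SSRLOCC A' B' A B Λ ∧ 1 - ε ≤ ψ.expect (Λ φ.proj)

end SSR

end

/-!
For `0 < p < 1`, let `φ` be the state in which Alice holds the single particle with probability `p`.
The Schmidt basis of `φ^⊗N` splits into blocks according to Alice's particle number, which is
binomially distributed with variance `N p (1 - p)`, and within each block `φ^⊗N` is maximally
entangled. The state E-EPR^⊗e ⊗ V-EPR^⊗v has the same structure, with a binomial distribution of
variance `v / 4` and with all blocks enlarged by the factor `2 ^ e`. For `v ≈ 4 p (1 - p) N` the
variances agree, and so do the two distributions up to translation. A maximally entangled block can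
be converted locally into any smaller one, coherently over all blocks, and near the mean of the
distributions the blocks of `φ^⊗N` have about `2 ^ (N E(φ) - v)` times as many elements as those of
V-EPR^⊗v. Sublinear fluctuations of the block sizes are absorbed by the slack `δ` in `e`. When
`E(φ) - V(φ) < δ`, `e` cannot be reduced below `0` and only the slack `E(φ) - V(φ)` is left; it is
positive unless `p = 1 / 2`, where `φ` is V-EPR up to phases.
-/

namespace SSR

section BinaryEntropy

open Real Filter Topology

theorem hasSum_log_two_sub_binEntropy {x : ℝ} (hx : |x| < 1) :
    HasSum (fun k : ℕ => (x ^ 2) ^ (k + 1) / ((2 * k + 1) * (2 * k + 2)))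
      (log 2 - binEntropy ((1 - x) / 2)) := by
  obtain ⟨hx₁, hx₂⟩ := abs_lt.1 hx
  have hsq : |x ^ 2| < 1 := by
    rw [abs_of_nonneg (sq_nonneg x), sq_lt_one_iff_abs_lt_one]
    exact hx
  have hodd := (hasSum_log_sub_log_of_abs_lt_one hx).mul_left (x / 2)
  have heven := (hasSum_pow_div_log_of_abs_lt_one hsq).mul_left (1 / 2)
  have hfactor : log (1 - x ^ 2) = log (1 - x) + log (1 + x) := by
    rw [← log_mul (by linarith) (by linarith)]
    ring_nf
  have hvalue : log 2 - binEntropy ((1 - x) / 2)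
      = x / 2 * (log (1 + x) - log (1 - x)) - 1 / 2 * -log (1 - x ^ 2) := by
    rw [hfactor, binEntropy_eq_negMulLog_add_negMulLog_one_sub, negMulLog, negMulLog,
      show 1 - (1 - x) / 2 = (1 + x) / 2 by ring, log_div (by linarith) two_ne_zero,
      log_div (by linarith) two_ne_zero]
    ring
  have hterm : ∀ k : ℕ, (x ^ 2) ^ (k + 1) / ((2 * k + 1) * (2 * k + 2))
      = x / 2 * (2 * (1 / (2 * k + 1)) * x ^ (2 * k + 1))
        - 1 / 2 * ((x ^ 2) ^ (k + 1) / (k + 1)) := fun k => by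
    field_simp
    ring
  simp_rw [hterm, hvalue]
  exact hodd.sub heven

-- `log 2 - binEntropy` is a power series in `x²` without constant term and with nonnegative
-- coefficients, so its quotient by `x²` increases.
theorem log_two_sub_binEntropy_mul_sq_lt {x y : ℝ} (hx : 0 < x) (hxy : x < y) (hy : y < 1) :
    (log 2 - binEntropy ((1 - x) / 2)) * y ^ 2 < (log 2 - binEntropy ((1 - y) / 2)) * x ^ 2 := by
  have hsumx := (hasSum_log_two_sub_binEntropy
    (abs_lt.2 ⟨by linarith, hxy.trans hy⟩)).mul_right (y ^ 2)
  have hsumy := (hasSum_log_two_sub_binEntropy (abs_lt.2 ⟨by linarith, hy⟩)).mul_right (x ^ 2)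
  have hsq : x ^ 2 < y ^ 2 := by gcongr
  have hterm : ∀ t u : ℝ, ∀ k : ℕ, t ^ (k + 1) / ((2 * k + 1) * (2 * k + 2)) * u
      = t * u * (t ^ k / ((2 * k + 1) * (2 * k + 2))) := fun t u k => by ring
  simp only [hterm, mul_comm (y ^ 2) (x ^ 2)] at hsumx hsumy
  refine hasSum_lt (i := 1) (fun k => ?_) ?_ hsumx hsumy
  · dsimp only
    gcongr
  · have hy : 0 < y := hx.trans hxy
    gcongr

theorem log_two_sub_binEntropy_lt {x : ℝ} (hx : 0 < x) (hx1 : x < 1) :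
    log 2 - binEntropy ((1 - x) / 2) < x ^ 2 * log 2 := by
  have hle : ∀ {y : ℝ}, 0 < y → y < 1 → log 2 - binEntropy ((1 - y) / 2) ≤ y ^ 2 * log 2 := by
    intro y hy hy1
    have hlim : Tendsto (fun z : ℝ => (log 2 - binEntropy ((1 - y) / 2)) * z ^ 2) (𝓝[<] 1)
        (𝓝 ((log 2 - binEntropy ((1 - y) / 2)) * 1 ^ 2)) :=
      (Continuous.tendsto (by fun_prop) 1).mono_left nhdsWithin_le_nhds
    rw [one_pow, mul_one] at hlim
    refine le_of_tendsto hlim ?_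
    filter_upwards [Ioo_mem_nhdsLT hy1] with z hz
    refine (log_two_sub_binEntropy_mul_sq_lt hy hz.1 hz.2).le.trans ?_
    rw [mul_comm]
    gcongr
    linarith [binEntropy_nonneg (p := (1 - z) / 2) (by linarith [hz.2]) (by linarith [hz.1])]
  obtain ⟨y, hxy, hy1⟩ := exists_between hx1
  have hy : 0 < y := hx.trans hxy
  refine lt_of_mul_lt_mul_right ((log_two_sub_binEntropy_mul_sq_lt hx hxy hy1).trans_le ?_)
    (sq_nonneg y)
  calc (log 2 - binEntropy ((1 - y) / 2)) * x ^ 2 ≤ (y ^ 2 * log 2) * x ^ 2 := by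
        gcongr
        exact hle hy hy1
    _ = x ^ 2 * log 2 * y ^ 2 := by ring

theorem four_mul_log_two_mul_lt_binEntropy {p : ℝ} (hp : 0 < p) (hp1 : p < 1) (hne : p ≠ 1 / 2) :
    4 * (p * (1 - p)) * log 2 < binEntropy p := by
  rcases lt_or_gt_of_ne hne with h | h
  · have := log_two_sub_binEntropy_lt (x := 1 - 2 * p) (by linarith) (by linarith)
    rw [show (1 - (1 - 2 * p)) / 2 = p by ring] at this
    linear_combination this
  · have := log_two_sub_binEntropy_lt (x := 2 * p - 1) (by linarith) (by linarith)
    rw [show (1 - (2 * p - 1)) / 2 = 1 - p by ring, binEntropy_one_sub] at this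
    linear_combination this

theorem four_mul_log_two_mul_le_binEntropy {p : ℝ} (hp : 0 ≤ p) (hp1 : p ≤ 1) :
    4 * (p * (1 - p)) * log 2 ≤ binEntropy p := by
  rcases hp.eq_or_lt with rfl | hp
  · simp
  rcases hp1.eq_or_lt with rfl | hp1
  · simp
  by_cases hne : p = 1 / 2
  · subst hne
    rw [one_div, binEntropy_two_inv]
    norm_num
  · exact (four_mul_log_two_mul_lt_binEntropy hp hp1 hne).le

end BinaryEntropy

section BinomialDistribution

open Real Finset

/-- The probability of `n` successes in `N` independent trials of success probability `p`. -/
noncomputable def binomialProb (N : ℕ) (p : ℝ) (n : ℕ) : ℝ :=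
  N.choose n * (p ^ n * (1 - p) ^ (N - n))

theorem binomialProb_pos {p : ℝ} (hp : 0 < p) (hp1 : p < 1) {N n : ℕ} (hn : n ≤ N) :
    0 < binomialProb N p n := by
  have := Nat.choose_pos hn
  have := sub_pos.2 hp1
  unfold binomialProb
  positivity

theorem binomialProb_nonneg {p : ℝ} (hp : 0 ≤ p) (hp1 : p ≤ 1) (N n : ℕ) :
    0 ≤ binomialProb N p n := by
  have := sub_nonneg.2 hp1
  unfold binomialProb
  positivity

theorem sum_binomialProb (N : ℕ) (p : ℝ) : ∑ n ∈ range (N + 1), binomialProb N p n = 1 := by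
  have h := add_pow p (1 - p) N
  rw [add_sub_cancel, one_pow] at h
  rw [h]
  exact sum_congr rfl fun n _ => mul_comm _ _

theorem eval_bernsteinPolynomial (N : ℕ) (p : ℝ) (n : ℕ) :
    (bernsteinPolynomial ℝ N n).eval p = binomialProb N p n := by
  simp [bernsteinPolynomial, binomialProb, mul_assoc]

theorem sum_sq_sub_mul_binomialProb (N : ℕ) (p : ℝ) :
    ∑ n ∈ range (N + 1), ((n : ℝ) - N * p) ^ 2 * binomialProb N p n = N * p * (1 - p) := by
  have h := congrArg (Polynomial.eval p) (bernsteinPolynomial.variance ℝ N)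
  simp only [Polynomial.eval_finsetSum, Polynomial.eval_mul, eval_bernsteinPolynomial,
    Polynomial.eval_pow, Polynomial.eval_sub, Polynomial.eval_X,
    Polynomial.eval_natCast, Polynomial.eval_one, nsmul_eq_mul] at h
  rw [← h]
  exact sum_congr rfl fun n _ => by ring

theorem sum_binomialProb_le_one {p : ℝ} (hp : 0 ≤ p) (hp1 : p ≤ 1) {N n M : ℕ}
    (h : n + M ≤ N + 1) : ∑ k ∈ range M, binomialProb N p (n + k) ≤ 1 := by
  rw [← sum_binomialProb N p, range_eq_Ico, sum_Ico_add, zero_add, range_eq_Ico]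
  exact sum_le_sum_of_subset_of_nonneg (Ico_subset_Ico (Nat.zero_le _) (by omega))
    fun i _ _ => binomialProb_nonneg hp hp1 N i

theorem one_sub_le_sum_binomialProb {p : ℝ} (hp : 0 ≤ p) (hp1 : p ≤ 1) (N : ℕ) (W : Finset ℕ)
    {T : ℝ} (hT : 0 < T) (hW : ∀ n ∉ W, T ≤ |(n : ℝ) - N * p|) :
    1 - N * p * (1 - p) / T ^ 2 ≤ ∑ n ∈ W, binomialProb N p n := by
  have hnonneg := binomialProb_nonneg hp hp1 N
  have htail : ∑ n ∈ range (N + 1) with n ∉ W, binomialProb N p n ≤ N * p * (1 - p) / T ^ 2 := by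
    rw [le_div_iff₀ (by positivity), ← sum_sq_sub_mul_binomialProb, sum_filter, sum_mul]
    refine sum_le_sum fun n _ => ?_
    split_ifs with hn
    · rw [zero_mul]
      exact mul_nonneg (sq_nonneg _) (hnonneg n)
    · rw [mul_comm, ← sq_abs (n - N * p : ℝ)]
      gcongr
      exacts [hnonneg n, hW n hn]
  have hsplit := sum_filter_add_sum_filter_not (range (N + 1)) (· ∈ W) (binomialProb N p)
  rw [sum_binomialProb] at hsplit
  have hin : ∑ n ∈ range (N + 1) with n ∈ W, binomialProb N p n ≤ ∑ n ∈ W, binomialProb N p n :=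
    sum_le_sum_of_subset_of_nonneg (fun n hn => (mem_filter.1 hn).2) fun n _ _ => hnonneg n
  linarith

theorem binomialProb_succ {p : ℝ} {N n : ℕ} (h : n < N) :
    binomialProb N p (n + 1) * ((n + 1) * (1 - p)) = binomialProb N p n * ((N - n) * p) := by
  have hchoose : (N.choose (n + 1) : ℝ) * (n + 1) = N.choose n * (N - n) := by
    have := congrArg (Nat.cast : ℕ → ℝ) (Nat.choose_succ_right_eq N n)
    push_cast [Nat.cast_sub h.le] at this
    exact this
  rw [binomialProb, binomialProb, show N - n = N - (n + 1) + 1 by omega, pow_succ, pow_succ]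
  linear_combination (p ^ n * p * (1 - p) ^ (N - (n + 1)) * (1 - p)) * hchoose

/-- `ρ` bounds the relative change, in one step, of the quotient of two binomial distributions
with the variances `S` and `S'`, at distance at most `T` from their means. -/
structure RatioBound (S S' T ρ : ℝ) : Prop where
  near : |S - S'| ≤ 1
  radius_le_left : 2 * T ≤ S
  radius_le_right : 2 * T ≤ S'
  nonneg : 0 ≤ ρ
  left_le : 4 * (2 * S + (T + 1) ^ 2) ≤ ρ * (S * S')
  right_le : 4 * (2 * S' + (T + 1) ^ 2) ≤ ρ * (S * S')

theorem RatioBound.symm {S S' T ρ : ℝ} (h : RatioBound S S' T ρ) : RatioBound S' S T ρ where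
  near := abs_sub_comm S S' ▸ h.near
  radius_le_left := h.radius_le_right
  radius_le_right := h.radius_le_left
  nonneg := h.nonneg
  left_le := mul_comm S S' ▸ h.right_le
  right_le := mul_comm S S' ▸ h.left_le

theorem RatioBound.cross_mul_le {S S' T ρ p p' s t : ℝ} (h : RatioBound S S' T ρ)
    (hp : 0 ≤ p) (hp1 : p ≤ 1) (hp' : 0 ≤ p') (hp1' : p' ≤ 1) (ht : |t| ≤ T) (hs : |s| ≤ T)
    (hst : |s - t| ≤ 1) :
    (S - p * t) * (S' + (1 - p') * (s + 1))
      ≤ (1 + ρ) * ((S + (1 - p) * (t + 1)) * (S' - p' * s)) := by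
  obtain ⟨hS, hTS, hTS', hρ, hρS, -⟩ := h
  rw [abs_le] at ht hs hst hS
  have hdiff : (S - p * t) * (S' + (1 - p') * (s + 1))
      - (S + (1 - p) * (t + 1)) * (S' - p' * s) ≤ 2 * S + (T + 1) ^ 2 := by
    have h₁ : S * (s - t + p - p') ≤ S * 2 := by
      gcongr <;> linarith
    have h₂ : (S - S') * (t + (1 - p)) ≤ T + 1 := by
      refine (le_abs_self _).trans ?_
      rw [abs_mul, ← one_mul (T + 1)]
      gcongr
      exacts [abs_le.2 hS, abs_le.2 ⟨by linarith, by linarith⟩]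
    have h₃ : p * (1 - p') * (-(t * (s + 1))) ≤ p * (1 - p') * (T * (T + 1)) := by
      refine mul_le_mul_of_nonneg_left ((neg_le_abs _).trans ?_)
        (mul_nonneg hp (sub_nonneg.2 hp1'))
      rw [abs_mul]
      gcongr
      exacts [by linarith, abs_le.2 ht, abs_le.2 ⟨by linarith, by linarith⟩]
    have h₄ : (1 - p) * p' * ((t + 1) * s) ≤ (1 - p) * p' * ((T + 1) * T) := by
      refine mul_le_mul_of_nonneg_left ((le_abs_self _).trans ?_)
        (mul_nonneg (sub_nonneg.2 hp1) hp')
      rw [abs_mul]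
      gcongr
      exacts [by linarith, abs_le.2 ⟨by linarith, by linarith⟩, abs_le.2 hs]
    have h₅ : (p * (1 - p') + (1 - p) * p') * (T * (T + 1)) ≤ 1 * (T * (T + 1)) := by
      have : 0 ≤ T * (T + 1) := mul_nonneg (by linarith) (by linarith)
      gcongr
      nlinarith
    linear_combination h₁ + h₂ + h₃ + h₄ + h₅
  have hden : S / 2 * (S' / 2) ≤ (S + (1 - p) * (t + 1)) * (S' - p' * s) := by
    have h₁ : -T ≤ (1 - p) * (t + 1) := by nlinarith
    have h₂ : p' * s ≤ T := by nlinarith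
    gcongr <;> linarith
  nlinarith [mul_le_mul_of_nonneg_left hden hρ]

theorem RatioBound.binomialProb_cross_step {N v n m : ℕ} {p p' T ρ : ℝ}
    (h : RatioBound (N * p * (1 - p)) (v * p' * (1 - p')) T ρ) (hp : 0 < p) (hp1 : p < 1)
    (hp' : 0 < p') (hp1' : p' < 1) (hn : n < N) (hm : m < v)
    (ht : |(n : ℝ) - N * p| ≤ T) (hs : |(m : ℝ) - v * p'| ≤ T)
    (hst : |(m - v * p' : ℝ) - (n - N * p)| ≤ 1) :
    binomialProb N p (n + 1) * binomialProb v p' m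
      ≤ (1 + ρ) * (binomialProb N p n * binomialProb v p' (m + 1)) := by
  have hratio := h.cross_mul_le hp.le hp1.le hp'.le hp1'.le ht hs hst
  have hNn : (0 : ℝ) < v - m := sub_pos.2 (Nat.cast_lt.2 hm)
  have : 0 < 1 - p := sub_pos.2 hp1
  have hpos : (0 : ℝ) < (n + 1) * (1 - p) * ((v - m) * p') := by positivity
  have hPQ : 0 ≤ binomialProb N p n * binomialProb v p' (m + 1) :=
    (mul_pos (binomialProb_pos hp hp1 hn.le) (binomialProb_pos hp' hp1' hm)).le
  refine le_of_mul_le_mul_right ?_ hpos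
  calc binomialProb N p (n + 1) * binomialProb v p' m * ((n + 1) * (1 - p) * ((v - m) * p'))
      = binomialProb N p n * binomialProb v p' (m + 1)
        * (((N - n) * p) * ((m + 1) * (1 - p'))) := by
        linear_combination (binomialProb v p' m * ((v - m) * p')) * binomialProb_succ (p := p) hn
          - (binomialProb N p n * ((N - n) * p)) * binomialProb_succ (p := p') hm
    _ ≤ binomialProb N p n * binomialProb v p' (m + 1)
        * ((1 + ρ) * ((n + 1) * (1 - p) * ((v - m) * p'))) := by
        refine mul_le_mul_of_nonneg_left ?_ hPQ
        linear_combination hratio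
    _ = _ := by ring

theorem mul_le_pow_mul_of_step {P Q : ℕ → ℝ} {r : ℝ} {M : ℕ}
    (hP : ∀ k ≤ M, 0 < P k) (hQ : ∀ k ≤ M, 0 < Q k) (hr : 0 ≤ r)
    (h : ∀ k < M, P k * Q (k + 1) ≤ r * (P (k + 1) * Q k)) {k l : ℕ} (hkl : k ≤ l) (hl : l ≤ M) :
    P k * Q l ≤ r ^ (l - k) * (P l * Q k) := by
  induction l, hkl using Nat.le_induction with
  | base => simp
  | succ l hkl ih =>
    have hPl := hP l (by omega)
    have hQl := hQ l (by omega)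
    have := hP k (by omega)
    have := hQ k (by omega)
    refine le_of_mul_le_mul_right ?_ (mul_pos hPl hQl)
    calc P k * Q (l + 1) * (P l * Q l) = (P k * Q l) * (P l * Q (l + 1)) := by ring
      _ ≤ (r ^ (l - k) * (P l * Q k)) * (r * (P (l + 1) * Q l)) := by
        have := hQ (l + 1) hl
        exact mul_le_mul (ih (by omega)) (h l (by omega)) (by positivity) (by positivity)
      _ = r ^ (l + 1 - k) * (P (l + 1) * Q k) * (P l * Q l) := by
        rw [Nat.sub_add_comm hkl, pow_succ]
        ring

end BinomialDistribution

section MatchedWindow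

open Real Finset

/-- The first index of the window of radius `τ` around the mean `N * p` of a binomial
distribution; the window consists of the indices `windowStart N p τ + k` with `k ≤ 2 * τ`. It
does not reach below `0` when `τ` is at most the variance `N * p * (1 - p)`. -/
noncomputable def windowStart (N : ℕ) (p : ℝ) (τ : ℕ) : ℕ := ⌊N * p⌋₊ - τ

/-- Windows of length `M` starting at `n` and `m`, respectively, on which `P` and `Q` agree up to
the factor `(1 - η) ^ 2`, the former having almost full weight. -/
structure MatchedWindow (P Q : ℕ → ℝ) (η : ℝ) (n m M : ℕ) : Prop where
  pos : ∀ k < M, 0 < P (n + k) ∧ 0 < Q (m + k)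
  left_le : ∀ k < M, (1 - η) ^ 2 * P (n + k) ≤ Q (m + k)
  right_le : ∀ k < M, (1 - η) ^ 2 * Q (m + k) ≤ P (n + k)
  weight : 1 - η ≤ ∑ k ∈ range M, P (n + k)

theorem cast_windowStart {N τ : ℕ} {p : ℝ} (hτ : τ ≤ N * p) :
    (windowStart N p τ : ℝ) = ⌊N * p⌋₊ - τ :=
  Nat.cast_sub (Nat.le_floor hτ)

theorem windowStart_add_le {N τ k : ℕ} {p : ℝ} (hp : 0 ≤ p)
    (hτ : τ ≤ N * p * (1 - p)) (hk : k ≤ 2 * τ) : windowStart N p τ + k ≤ N := by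
  have hmean : (0 : ℝ) ≤ N * p := by positivity
  have hle : (τ : ℝ) ≤ N * p := by nlinarith
  have hfloor := Nat.floor_le hmean
  have hk' : (k : ℝ) ≤ 2 * τ := by exact_mod_cast hk
  have hNq : (τ : ℝ) ≤ N - N * p := by
    nlinarith [mul_nonneg (Nat.cast_nonneg (α := ℝ) N) (sq_nonneg (1 - p))]
  have : (windowStart N p τ + k : ℝ) ≤ N := by
    rw [cast_windowStart hle]
    linarith
  exact_mod_cast this

theorem abs_windowStart_add_sub_le {N τ k : ℕ} {p : ℝ} (hτ : τ ≤ N * p) (hk : k ≤ 2 * τ) :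
    |(windowStart N p τ + k : ℝ) - N * p| ≤ τ + 1 := by
  have hk' : (k : ℝ) ≤ 2 * τ := by exact_mod_cast hk
  have hfloor := Nat.floor_le ((Nat.cast_nonneg τ).trans hτ)
  have hfloor' := Nat.lt_floor_add_one (N * p)
  rw [cast_windowStart hτ, abs_le]
  constructor <;> linarith [(Nat.cast_nonneg k : (0 : ℝ) ≤ k)]

theorem abs_windowStart_sub_windowStart_le {N v τ k : ℕ} {p p' : ℝ} (hτ : τ ≤ N * p)
    (hτ' : τ ≤ v * p') :
    |((windowStart v p' τ + k : ℝ) - v * p') - ((windowStart N p τ + k) - N * p)| ≤ 1 := by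
  have hfloor := Nat.floor_le ((Nat.cast_nonneg τ).trans hτ)
  have hfloor' := Nat.floor_le ((Nat.cast_nonneg τ).trans hτ')
  have := Nat.lt_floor_add_one (N * p)
  have := Nat.lt_floor_add_one (v * p')
  rw [cast_windowStart hτ, cast_windowStart hτ', abs_le]
  constructor <;> linarith

theorem one_sub_le_sum_window {N τ : ℕ} {p : ℝ} (hp : 0 ≤ p) (hp1 : p ≤ 1) (h0 : 0 < τ)
    (hτ : τ ≤ N * p) :
    1 - N * p * (1 - p) / τ ^ 2
      ≤ ∑ k ∈ range (2 * τ + 1), binomialProb N p (windowStart N p τ + k) := by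
  have hfloor := Nat.floor_le ((Nat.cast_nonneg τ).trans hτ)
  have hfloor' := Nat.lt_floor_add_one (N * p)
  rw [range_eq_Ico, sum_Ico_add, zero_add]
  refine one_sub_le_sum_binomialProb hp hp1 N _ (Nat.cast_pos.2 h0) fun n hn => ?_
  rw [mem_Ico, not_and_or, not_le, not_lt] at hn
  rcases hn with hn | hn
  · have : (n : ℝ) + 1 ≤ windowStart N p τ := by exact_mod_cast hn
    rw [cast_windowStart hτ] at this
    exact le_abs.2 (Or.inr (by linarith))
  · have : (2 * τ + 1 + windowStart N p τ : ℝ) ≤ n := by exact_mod_cast hn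
    rw [cast_windowStart hτ] at this
    exact le_abs.2 (Or.inl (by linarith))

theorem mul_le_of_cross_le {P Q : ℕ → ℝ} {η : ℝ} {W : Finset ℕ} (hη : η ≤ 1)
    (hP : ∀ k ∈ W, 0 ≤ P k) (hQ : ∀ k ∈ W, 0 ≤ Q k)
    (hQ1 : 1 - η ≤ ∑ k ∈ W, Q k) (hP1 : ∑ k ∈ W, P k ≤ 1)
    (h : ∀ k ∈ W, ∀ l ∈ W, (1 - η) * (P k * Q l) ≤ P l * Q k) {k : ℕ} (hk : k ∈ W) :
    (1 - η) ^ 2 * P k ≤ Q k := by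
  have hsum := sum_le_sum (h k hk)
  rw [← mul_sum, ← mul_sum, ← sum_mul] at hsum
  calc (1 - η) ^ 2 * P k = (1 - η) * (P k * (1 - η)) := by ring
    _ ≤ (1 - η) * (P k * ∑ l ∈ W, Q l) := mul_le_mul_of_nonneg_left
        (mul_le_mul_of_nonneg_left hQ1 (hP k hk)) (sub_nonneg.2 hη)
    _ ≤ (∑ l ∈ W, P l) * Q k := hsum
    _ ≤ Q k := mul_le_of_le_one_left (hQ k hk) hP1

theorem MatchedWindow.of_cross_le {P Q : ℕ → ℝ} {η : ℝ} {n m M : ℕ} (hη : η ≤ 1)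
    (hpos : ∀ k < M, 0 < P (n + k) ∧ 0 < Q (m + k))
    (hP : 1 - η ≤ ∑ k ∈ range M, P (n + k)) (hP1 : ∑ k ∈ range M, P (n + k) ≤ 1)
    (hQ : 1 - η ≤ ∑ k ∈ range M, Q (m + k)) (hQ1 : ∑ k ∈ range M, Q (m + k) ≤ 1)
    (h : ∀ k < M, ∀ l < M,
      (1 - η) * (P (n + k) * Q (m + l)) ≤ P (n + l) * Q (m + k)) :
    MatchedWindow P Q η n m M where
  pos := hpos
  weight := hP
  left_le k hk := mul_le_of_cross_le (P := fun k => P (n + k)) (Q := fun k => Q (m + k))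
    (W := range M) hη (fun k hk => (hpos k (mem_range.1 hk)).1.le)
    (fun k hk => (hpos k (mem_range.1 hk)).2.le) hQ hP1
    (fun k hk l hl => h k (mem_range.1 hk) l (mem_range.1 hl)) (mem_range.2 hk)
  right_le k hk := mul_le_of_cross_le (P := fun k => Q (m + k)) (Q := fun k => P (n + k))
    (W := range M) hη (fun k hk => (hpos k (mem_range.1 hk)).2.le)
    (fun k hk => (hpos k (mem_range.1 hk)).1.le) hP hQ1
    (fun k hk l hl => by
      rw [mul_comm (Q _), mul_comm (Q _)]
      exact h l (mem_range.1 hl) k (mem_range.1 hk)) (mem_range.2 hk)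

theorem MatchedWindow.one_sub_le_sq_sum_sqrt {P Q : ℕ → ℝ} {η : ℝ} {n m M : ℕ}
    (h : MatchedWindow P Q η n m M) (hη : η ≤ 1) :
    1 - 4 * η ≤ (∑ k ∈ range M, √(P (n + k) * Q (m + k))) ^ 2 := by
  have hterm : ∀ k ∈ range M, (1 - η) * P (n + k) ≤ √(P (n + k) * Q (m + k)) := fun k hk => by
    have hk := mem_range.1 hk
    refine Real.le_sqrt_of_sq_le ?_
    rw [mul_pow, sq (P _), mul_left_comm]
    gcongr
    exacts [(h.pos k hk).1.le, h.left_le k hk]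
  have hsum : (1 - η) ^ 2 ≤ ∑ k ∈ range M, √(P (n + k) * Q (m + k)) := by
    refine le_trans ?_ (sum_le_sum hterm)
    rw [← mul_sum, sq]
    exact mul_le_mul_of_nonneg_left h.weight (sub_nonneg.2 hη)
  calc 1 - 4 * η = 1 + (4 : ℕ) * (-η) := by push_cast; ring
    _ ≤ (1 + -η) ^ 4 := one_add_mul_le_pow (by linarith) 4
    _ = ((1 - η) ^ 2) ^ 2 := by ring
    _ ≤ _ := by gcongr

theorem RatioBound.binomialProb_cross_window {N v τ : ℕ} {p p' ρ : ℝ}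
    (h : RatioBound (N * p * (1 - p)) (v * p' * (1 - p')) (τ + 1) ρ) (hp : 0 < p) (hp1 : p < 1)
    (hp' : 0 < p') (hp1' : p' < 1) {k l : ℕ} (hkl : k ≤ l) (hl : l ≤ 2 * τ) :
    binomialProb N p (windowStart N p τ + k) * binomialProb v p' (windowStart v p' τ + l)
      ≤ (1 + ρ) ^ (l - k) * (binomialProb N p (windowStart N p τ + l)
        * binomialProb v p' (windowStart v p' τ + k)) := by
  have hle : ∀ {N : ℕ} {p : ℝ}, 0 < p → 2 * (τ + 1) ≤ N * p * (1 - p) →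
      (τ : ℝ) ≤ N * p * (1 - p) ∧ τ ≤ N * p := fun {N p} hp h => by
    have : (0 : ℝ) ≤ N * p := by positivity
    have : (0 : ℝ) ≤ τ := by positivity
    constructor <;> nlinarith
  have hτ := hle hp h.radius_le_left
  have hτ' := hle hp' h.radius_le_right
  have hrange := fun {j} => windowStart_add_le (k := j) hp.le hτ.1
  have hrange' := fun {j} => windowStart_add_le (k := j) hp'.le hτ'.1
  refine mul_le_pow_mul_of_step (M := 2 * τ)
    (P := fun k => binomialProb N p (windowStart N p τ + k))
    (Q := fun k => binomialProb v p' (windowStart v p' τ + k))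
    (fun j hj => binomialProb_pos hp hp1 (hrange hj))
    (fun j hj => binomialProb_pos hp' hp1' (hrange' hj)) (by linarith [h.nonneg])
    (fun j hj => ?_) hkl hl
  have hst := abs_windowStart_sub_windowStart_le (k := j) hτ'.2 hτ.2
  have hstep := h.symm.binomialProb_cross_step (n := windowStart v p' τ + j)
    (m := windowStart N p τ + j) hp' hp1' hp hp1 (hrange' (j := j + 1) hj)
    (hrange (j := j + 1) hj)
    (by exact_mod_cast abs_windowStart_add_sub_le hτ'.2 hj.le)
    (by exact_mod_cast abs_windowStart_add_sub_le hτ.2 hj.le)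
    (by exact_mod_cast hst)
  linear_combination hstep

theorem one_sub_mul_one_add_pow_le_one {ρ η : ℝ} {M j : ℕ} (hρ : 0 ≤ ρ) (hη : M * ρ ≤ η)
    (hj : j ≤ M) : (1 - η) * (1 + ρ) ^ j ≤ 1 := by
  have hpow : (1 + ρ) ^ j ≤ exp η := by
    calc (1 + ρ) ^ j ≤ exp ρ ^ j := by
          gcongr
          linarith [add_one_le_exp ρ]
      _ = exp (j * ρ) := (exp_nat_mul ρ j).symm
      _ ≤ exp η := by
          gcongr
          refine le_trans ?_ hη
          gcongr
  calc (1 - η) * (1 + ρ) ^ j ≤ exp (-η) * exp η :=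
        mul_le_mul (one_sub_le_exp_neg η) hpow (by positivity) (exp_pos _).le
    _ = 1 := by rw [← exp_add, neg_add_cancel, exp_zero]

theorem RatioBound.one_sub_mul_binomialProb_cross_window {N v τ : ℕ} {p p' ρ η : ℝ}
    (h : RatioBound (N * p * (1 - p)) (v * p' * (1 - p')) (τ + 1) ρ) (hp : 0 < p) (hp1 : p < 1)
    (hp' : 0 < p') (hp1' : p' < 1) (hη : η ≤ 1) (hρη : 2 * τ * ρ ≤ η) {k l : ℕ}
    (hk : k ≤ 2 * τ) (hl : l ≤ 2 * τ) :
    (1 - η) * (binomialProb N p (windowStart N p τ + k)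
        * binomialProb v p' (windowStart v p' τ + l))
      ≤ binomialProb N p (windowStart N p τ + l)
        * binomialProb v p' (windowStart v p' τ + k) := by
  have hnonneg : 0 ≤ binomialProb N p (windowStart N p τ + l)
      * binomialProb v p' (windowStart v p' τ + k) :=
    mul_nonneg (binomialProb_nonneg hp.le hp1.le _ _) (binomialProb_nonneg hp'.le hp1'.le _ _)
  obtain ⟨j, hj, hcross⟩ : ∃ j ≤ 2 * τ, binomialProb N p (windowStart N p τ + k)
        * binomialProb v p' (windowStart v p' τ + l)
      ≤ (1 + ρ) ^ j * (binomialProb N p (windowStart N p τ + l)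
        * binomialProb v p' (windowStart v p' τ + k)) := by
    rcases le_total k l with hkl | hlk
    · exact ⟨l - k, by omega, h.binomialProb_cross_window hp hp1 hp' hp1' hkl hl⟩
    · refine ⟨k - l, by omega, ?_⟩
      linear_combination h.symm.binomialProb_cross_window hp' hp1' hp hp1 hlk hk
  calc _ ≤ (1 - η) * ((1 + ρ) ^ j * _) :=
        mul_le_mul_of_nonneg_left hcross (sub_nonneg.2 hη)
    _ = (1 - η) * (1 + ρ) ^ j * _ := (mul_assoc _ _ _).symm
    _ ≤ _ := mul_le_of_le_one_left hnonneg
        (one_sub_mul_one_add_pow_le_one h.nonneg (by exact_mod_cast hρη) hj)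

theorem MatchedWindow.of_ratioBound {N v τ : ℕ} {p p' ρ η : ℝ}
    (h : RatioBound (N * p * (1 - p)) (v * p' * (1 - p')) (τ + 1) ρ) (hp : 0 < p) (hp1 : p < 1)
    (hp' : 0 < p') (hp1' : p' < 1) (hη : η ≤ 1) (hρη : 2 * τ * ρ ≤ η) (h0 : 0 < τ)
    (htail : N * p * (1 - p) ≤ η * τ ^ 2) (htail' : v * p' * (1 - p') ≤ η * τ ^ 2) :
    MatchedWindow (binomialProb N p) (binomialProb v p') η (windowStart N p τ)
      (windowStart v p' τ) (2 * τ + 1) := by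
  have hweight : ∀ {N : ℕ} {p : ℝ}, 0 < p → p < 1 → 2 * (τ + 1) ≤ N * p * (1 - p) →
      N * p * (1 - p) ≤ η * τ ^ 2 → (∀ k < 2 * τ + 1, windowStart N p τ + k ≤ N) ∧
        1 - η ≤ ∑ k ∈ range (2 * τ + 1), binomialProb N p (windowStart N p τ + k) := by
    intro N p hp hp1 hτ htail
    have : (0 : ℝ) ≤ N * p := by positivity
    have : (0 : ℝ) < τ := Nat.cast_pos.2 h0
    refine ⟨fun k hk => windowStart_add_le hp.le (by linarith) (by omega),
      le_trans ?_ (one_sub_le_sum_window hp.le hp1.le h0 (by nlinarith))⟩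
    gcongr
    rwa [div_le_iff₀ (by positivity)]
  obtain ⟨hrange, hP⟩ := hweight hp hp1 h.radius_le_left htail
  obtain ⟨hrange', hQ⟩ := hweight hp' hp1' h.radius_le_right htail'
  have hend := hrange (2 * τ) (by omega)
  have hend' := hrange' (2 * τ) (by omega)
  exact .of_cross_le hη
    (fun k hk => ⟨binomialProb_pos hp hp1 (hrange k hk), binomialProb_pos hp' hp1' (hrange' k hk)⟩)
    hP (sum_binomialProb_le_one hp.le hp1.le (by omega))
    hQ (sum_binomialProb_le_one hp'.le hp1'.le (by omega))
    fun k hk l hl => h.one_sub_mul_binomialProb_cross_window hp hp1 hp' hp1' hη hρη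
      (by omega) (by omega)

theorem ratioBound_of_sq_le {σ S' L T : ℝ} (hnear : |σ ^ 2 - S'| ≤ 1) (hL : 2 ≤ L)
    (hσ : 8 * L ≤ σ) (hT0 : 0 ≤ T) (hT : T + 1 ≤ 2 * (L * σ)) :
    RatioBound (σ ^ 2) S' T (48 * L ^ 2 / σ ^ 2) := by
  obtain ⟨h₁, h₂⟩ := abs_le.1 hnear
  have hσ16 : 16 ≤ σ := by linarith
  have hLσ : 8 * (L * σ) ≤ σ ^ 2 := by nlinarith
  have hS' : σ ^ 2 / 2 ≤ S' := by nlinarith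
  have hTsq : (T + 1) ^ 2 ≤ (2 * (L * σ)) ^ 2 := by gcongr
  have hLsq : 4 * σ ^ 2 ≤ L ^ 2 * σ ^ 2 := by
    gcongr
    nlinarith
  have hρ : 48 * L ^ 2 * (σ ^ 2 / 2) ≤ 48 * L ^ 2 / σ ^ 2 * (σ ^ 2 * S') := by
    rw [← mul_assoc (_ / _), div_mul_cancel₀ _ (by positivity)]
    gcongr
  exact ⟨hnear, by linarith, by linarith, by positivity, by linarith, by linarith⟩

theorem exists_window_radius {σ η L : ℝ} (hL : 2 ≤ L) (hηL : η * L = 2) (hσ : 96 * L ^ 4 ≤ σ) :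
    ∃ τ : ℕ, 0 < τ ∧ (τ : ℝ) + 2 ≤ 2 * (L * σ) ∧ 2 * τ * (48 * L ^ 2 / σ ^ 2) ≤ η ∧
      2 * σ ^ 2 ≤ η * τ ^ 2 := by
  have hη : 0 < η := pos_of_mul_pos_left (hηL ▸ two_pos) (by linarith)
  have hσ1 : 1 ≤ σ := by nlinarith [one_le_pow₀ (n := 4) (one_le_two.trans hL)]
  obtain ⟨τ, hτ, hτ'⟩ : ∃ τ : ℕ, L * σ ≤ τ ∧ (τ : ℝ) ≤ L * σ + 1 :=
    ⟨⌈L * σ⌉₊, Nat.le_ceil _, (Nat.ceil_lt_add_one (by positivity)).le⟩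
  have hτL : (τ : ℝ) + 2 ≤ 2 * (L * σ) := by
    have : 96 ≤ σ := by nlinarith [one_le_pow₀ (n := 4) (one_le_two.trans hL)]
    nlinarith
  have hL3 : 192 * L ^ 3 ≤ η * σ := by
    refine le_of_mul_le_mul_left ?_ (by linarith : 0 < L)
    linear_combination 2 * hσ - σ * hηL
  refine ⟨τ, Nat.cast_pos.1 (lt_of_lt_of_le (by positivity) hτ), hτL, ?_, ?_⟩
  · calc 2 * τ * (48 * L ^ 2 / σ ^ 2) ≤ 2 * (2 * (L * σ)) * (48 * L ^ 2 / σ ^ 2) := by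
          gcongr
          linarith
      _ = 192 * L ^ 3 / σ := by
          field_simp
          ring
      _ ≤ η := by rwa [div_le_iff₀ (by linarith)]
  · calc 2 * σ ^ 2 ≤ L * (η * L) * σ ^ 2 := by
          rw [hηL]
          gcongr
          linarith
      _ = η * (L * σ) ^ 2 := by ring
      _ ≤ η * τ ^ 2 := by gcongr

theorem exists_matchedWindow_binomialProb {N v : ℕ} {p p' σ η : ℝ} (hp : 0 < p) (hp1 : p < 1)
    (hp' : 0 < p') (hp1' : p' < 1) (hσ : σ ^ 2 = N * p * (1 - p))
    (hS : |N * p * (1 - p) - v * p' * (1 - p')| ≤ 1) (h0 : 0 < η) (hη : η ≤ 1)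
    (hlarge : 1536 ≤ η ^ 4 * σ) :
    ∃ n m M : ℕ, MatchedWindow (binomialProb N p) (binomialProb v p') η n m M ∧
      ∀ k < M, n + k ≤ N ∧ m + k ≤ v ∧ |(n + k : ℝ) - N * p| ≤ 4 / η * σ := by
  obtain ⟨L, hL, hηL⟩ : ∃ L, 2 ≤ L ∧ η * L = 2 :=
    ⟨2 / η, by rw [le_div_iff₀ h0]; linarith, mul_div_cancel₀ _ h0.ne'⟩
  have hL4 : 96 * L ^ 4 ≤ σ := by
    refine le_of_mul_le_mul_left ?_ (pow_pos h0 4)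
    calc η ^ 4 * (96 * L ^ 4) = 96 * (η * L) ^ 4 := by ring
      _ ≤ η ^ 4 * σ := by rw [hηL]; linarith
  have hσL : 768 * L ≤ σ := by
    have : L * 2 ^ 3 ≤ L * L ^ 3 := by gcongr
    linarith
  obtain ⟨τ, hτ0, hτL, hρ, htail⟩ := exists_window_radius hL hηL hL4
  have hbound : RatioBound (N * p * (1 - p)) (v * p' * (1 - p')) (τ + 1) (48 * L ^ 2 / σ ^ 2) := by
    rw [← hσ] at hS ⊢
    exact ratioBound_of_sq_le hS hL (by linarith) (by positivity) (by linarith)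
  have hσ0 : 0 < σ := by linarith
  have : 1 ≤ σ ^ 2 := one_le_pow₀ (by linarith)
  have hmean : N * p * (1 - p) ≤ N * p := mul_le_of_le_one_right (by positivity) (by linarith)
  have hτS := hbound.radius_le_left
  refine ⟨windowStart N p τ, windowStart v p' τ, 2 * τ + 1,
    .of_ratioBound hbound hp hp1 hp' hp1' hη hρ hτ0 (by linarith)
      (by linarith [(abs_le.1 hS).1]), fun k hk => ⟨?_, ?_, ?_⟩⟩
  · exact windowStart_add_le hp.le (by linarith) (by omega)
  · exact windowStart_add_le hp'.le (by linarith [hbound.radius_le_right]) (by omega)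
  · calc _ ≤ (τ : ℝ) + 1 := abs_windowStart_add_sub_le (by linarith) (by omega)
      _ ≤ 2 * (L * σ) := by linarith
      _ = 4 / η * σ := by
          field_simp
          linear_combination 2 * hηL

end MatchedWindow

section Protocols

variable {A B C A' B' : LocalSystem} {J : Type}

/-- The operator `K` changes the local particle number by a fixed integer, as the superselection
rule requires of a Kraus operator. -/
def HasShift (K : Matrix C.ι A.ι ℂ) : Prop :=
  ∃ Δ : ℤ, ∀ c a, K c a ≠ 0 → (C.num c : ℤ) = (A.num a : ℤ) + Δ

theorem hasShift_single (c : C.ι) (a : A.ι) (z : ℂ) :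
    HasShift (Matrix.single c a z : Matrix C.ι A.ι ℂ) := by
  refine ⟨(C.num c : ℤ) - A.num a, fun c' a' h => ?_⟩
  obtain ⟨rfl, rfl⟩ : c = c' ∧ a = a' := by
    by_contra hne
    exact h (Matrix.single_apply_of_ne (h := hne) ..)
  ring

theorem Ket.expect_sum [Fintype J] (ψ : Ket A B) (O : J → Op A B) :
    ψ.expect (∑ j, O j) = ∑ j, ψ.expect (O j) := by
  simp only [Ket.expect, Matrix.sum_mulVec, dotProduct_sum, Complex.re_sum]

theorem Ket.expect_proj (φ ψ : Ket A B) : ψ.expect φ.proj = ‖star ψ ⬝ᵥ φ‖ ^ 2 := by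
  rw [Ket.expect, Ket.proj, Matrix.vecMulVec_mulVec, op_smul_eq_smul, dotProduct_smul, smul_eq_mul,
    Matrix.star_dotProduct φ ψ, Complex.star_def, ← Complex.normSq_eq_conj_mul_self,
    Complex.ofReal_re, Complex.normSq_eq_norm_sq]

theorem Ket.proj_mulVec (M : Matrix (A'.ι × B'.ι) (A.ι × B.ι) ℂ) (φ : Ket A B) :
    Ket.proj (A := A') (B := B') (M *ᵥ φ) = M * φ.proj * Mᴴ := by
  rw [Ket.proj, Ket.proj, Matrix.mul_vecMulVec, Matrix.vecMulVec_mul, ← Matrix.star_mulVec]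

/-- Some SSR-LOCC protocol turns `φ` into an operator whose fidelity with `ψ` is at least `F`. The
vector `φ` need not be normalised: after a measurement, each outcome leaves a vector whose squared
norm is the probability of that outcome, and the fidelities of the outcomes add up. -/
def ReachesFidelity (φ : Ket A B) (ψ : Ket A' B') (F : ℝ) : Prop :=
  ∃ Λ : Op A B → Op A' B', SSRLOCC A' B' A B Λ ∧ F ≤ ψ.expect (Λ φ.proj)

theorem reachesFidelity_self (φ ψ : Ket A B) : ReachesFidelity φ ψ (‖star ψ ⬝ᵥ φ‖ ^ 2) :=
  ⟨_, SSRLOCC.done, (Ket.expect_proj φ ψ).ge⟩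

theorem ReachesFidelity.mono {φ : Ket A B} {ψ : Ket A' B'} {F G : ℝ} (h : ReachesFidelity φ ψ F)
    (hGF : G ≤ F) : ReachesFidelity φ ψ G :=
  let ⟨Λ, hΛ, hF⟩ := h
  ⟨Λ, hΛ, hGF.trans hF⟩

theorem ReachesFidelity.alice [Fintype J] {φ : Ket A B} {ψ : Ket A' B'} {F : J → ℝ}
    {K : J → Matrix C.ι A.ι ℂ} (hK : ∑ j, (K j)ᴴ * K j = 1) (hs : ∀ j, HasShift (K j))
    (h : ∀ j, ReachesFidelity (A := C) ((K j ⊗ₖ (1 : Matrix B.ι B.ι ℂ)) *ᵥ φ) ψ (F j)) :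
    ReachesFidelity φ ψ (∑ j, F j) := by
  choose Λ hΛ hF using h
  let e := (Fintype.equivFin J).symm
  have hKe : IsMeasurement (C := fun _ => C) fun i => K (e i) :=
    ⟨by rw [← hK]; exact e.sum_comp fun j => (K j)ᴴ * K j, fun i => hs (e i)⟩
  refine ⟨_, SSRLOCC.alice _ hKe _ fun i => hΛ (e i), ?_⟩
  simp only [Ket.expect_sum, ← Ket.proj_mulVec]
  rw [← e.sum_comp]
  exact Finset.sum_le_sum fun i _ => hF (e i)

theorem ReachesFidelity.bob [Fintype J] {φ : Ket A B} {ψ : Ket A' B'} {F : J → ℝ}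
    {K : J → Matrix C.ι B.ι ℂ} (hK : ∑ j, (K j)ᴴ * K j = 1) (hs : ∀ j, HasShift (K j))
    (h : ∀ j, ReachesFidelity (B := C) (((1 : Matrix A.ι A.ι ℂ) ⊗ₖ K j) *ᵥ φ) ψ (F j)) :
    ReachesFidelity φ ψ (∑ j, F j) := by
  choose Λ hΛ hF using h
  let e := (Fintype.equivFin J).symm
  have hKe : IsMeasurement (C := fun _ => C) fun i => K (e i) :=
    ⟨by rw [← hK]; exact e.sum_comp fun j => (K j)ᴴ * K j, fun i => hs (e i)⟩
  refine ⟨_, SSRLOCC.bob _ hKe _ fun i => hΛ (e i), ?_⟩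
  simp only [Ket.expect_sum, ← Ket.proj_mulVec]
  rw [← e.sum_comp]
  exact Finset.sum_le_sum fun i _ => hF (e i)

/-- A family of Kraus operators of an SSR measurement from which outcomes may be missing: `∑ Kᴴ K`
is diagonal in the particle number basis, with entries at most `1` instead of equal to `1`. -/
structure IsPartialMeasurement [Fintype J] (K : J → Matrix C.ι A.ι ℂ) : Prop where
  hasShift : ∀ j, HasShift (K j)
  sum_eq : ∃ s : A.ι → ℝ, (∀ a, s a ≤ 1) ∧
    ∑ j, (K j)ᴴ * K j = Matrix.diagonal fun a => (s a : ℂ)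

/-- The missing outcomes of a partial measurement with `∑ Kᴴ K = diagonal s`: outcome `a` replaces
the basis vector `a` by `c` with the remaining weight `1 - s a`. -/
noncomputable def failure (s : A.ι → ℝ) (c : C.ι) (a : A.ι) : Matrix C.ι A.ι ℂ :=
  Matrix.single c a ((Real.sqrt (1 - s a) : ℝ) : ℂ)

theorem sum_failure {s : A.ι → ℝ} (hs : ∀ a, s a ≤ 1) (c : C.ι) :
    ∑ a, (failure s c a : Matrix C.ι A.ι ℂ)ᴴ * failure s c a
      = 1 - Matrix.diagonal fun a => (s a : ℂ) := by
  have hterm : ∀ a, (failure s c a : Matrix C.ι A.ι ℂ)ᴴ * failure s c a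
      = Matrix.single a a ((1 - s a : ℝ) : ℂ) := fun a => by
    rw [failure, Matrix.conjTranspose_single, Matrix.single_mul_single_same, Complex.star_def,
      Complex.conj_ofReal, ← Complex.ofReal_mul, Real.mul_self_sqrt (sub_nonneg.2 (hs a))]
  simp only [hterm, Matrix.sum_single_eq_diagonal]
  rw [← Matrix.diagonal_one, Matrix.diagonal_sub]
  simp

theorem reachesFidelity_zero [Nonempty A'.ι] [Nonempty B'.ι] (φ : Ket A B) (ψ : Ket A' B') :
    ReachesFidelity φ ψ 0 := by
  have hcomplete {D D' : LocalSystem} (d : D'.ι) :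
      ∑ a, (failure (0 : D.ι → ℝ) d a : Matrix D'.ι D.ι ℂ)ᴴ * failure 0 d a = 1 := by
    rw [sum_failure (s := 0) fun _ => zero_le_one]
    simp
  refine .mono (.alice (hcomplete (Classical.arbitrary A'.ι)) (fun _ => hasShift_single _ _ _)
    fun a => .bob (hcomplete (Classical.arbitrary B'.ι)) (fun _ => hasShift_single _ _ _)
      fun b => reachesFidelity_self _ _) ?_
  exact Finset.sum_nonneg fun _ _ => Finset.sum_nonneg fun _ _ => sq_nonneg _

namespace IsPartialMeasurement

variable [Fintype J] {φ : Ket A B} {ψ : Ket A' B'} {F : J → ℝ}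

theorem exists_completion {K : J → Matrix C.ι A.ι ℂ} (hK : IsPartialMeasurement K) (c : C.ι) :
    ∃ L : J ⊕ A.ι → Matrix C.ι A.ι ℂ, (∀ j, L (Sum.inl j) = K j) ∧
      ∑ i, (L i)ᴴ * L i = 1 ∧ ∀ i, HasShift (L i) := by
  obtain ⟨s, hs, hsum⟩ := hK.sum_eq
  refine ⟨Sum.elim K (failure s c), fun _ => rfl, ?_, ?_⟩
  · simp only [Fintype.sum_sum_type, Sum.elim_inl, Sum.elim_inr, hsum, sum_failure hs]
    abel
  · rintro (j | a)
    exacts [hK.hasShift j, hasShift_single _ _ _]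

theorem reachesFidelity_alice [Nonempty C.ι] [Nonempty A'.ι] [Nonempty B'.ι]
    {K : J → Matrix C.ι A.ι ℂ} (hK : IsPartialMeasurement K)
    (h : ∀ j, ReachesFidelity (A := C) ((K j ⊗ₖ (1 : Matrix B.ι B.ι ℂ)) *ᵥ φ) ψ (F j)) :
    ReachesFidelity φ ψ (∑ j, F j) := by
  obtain ⟨L, hLK, hL, hshift⟩ := hK.exists_completion (Classical.arbitrary C.ι)
  refine .mono (.alice hL hshift (F := Sum.elim F 0) ?_) (by simp)
  rintro (j | a)
  · simpa only [hLK, Sum.elim_inl] using h j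
  · exact reachesFidelity_zero _ _

theorem reachesFidelity_bob [Nonempty C.ι] [Nonempty A'.ι] [Nonempty B'.ι]
    {K : J → Matrix C.ι B.ι ℂ} (hK : IsPartialMeasurement K)
    (h : ∀ j, ReachesFidelity (B := C) (((1 : Matrix A.ι A.ι ℂ) ⊗ₖ K j) *ᵥ φ) ψ (F j)) :
    ReachesFidelity φ ψ (∑ j, F j) := by
  obtain ⟨L, hLK, hL, hshift⟩ := hK.exists_completion (Classical.arbitrary C.ι)
  refine .mono (.bob hL hshift (F := Sum.elim F 0) ?_) (by simp)
  rintro (j | a)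
  · simpa only [hLK, Sum.elim_inl] using h j
  · exact reachesFidelity_zero _ _

theorem reachesFidelity_oneWay [Nonempty A'.ι] [Nonempty B'.ι]
    {K : J → Matrix A'.ι A.ι ℂ} {U : J → Matrix B'.ι B.ι ℂ} (hK : IsPartialMeasurement K)
    (hU : ∀ j, IsPartialMeasurement fun _ : Unit => U j) :
    ReachesFidelity φ ψ (∑ j, ‖star ψ ⬝ᵥ ((K j ⊗ₖ U j) *ᵥ φ)‖ ^ 2) := by
  refine hK.reachesFidelity_alice fun j => .mono
    ((hU j).reachesFidelity_bob fun _ => reachesFidelity_self _ _) ?_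
  rw [Fintype.sum_unique, Matrix.mulVec_mulVec, ← Matrix.mul_kronecker_mul, Matrix.one_mul,
    Matrix.mul_one]

end IsPartialMeasurement

end Protocols

section Transfer

/-- The operator `∑ t, z t |f t⟩⟨g t|`, which moves the basis vectors `g t` to the basis vectors
`f t` with amplitudes `z t`. -/
noncomputable def transfer {T C A : Type} [Fintype T] [DecidableEq C] [DecidableEq A]
    (f : T → C) (g : T → A) (z : T → ℂ) : Matrix C A ℂ :=
  ∑ t, Matrix.single (f t) (g t) (z t)

variable {T : Type} [Fintype T]

theorem transfer_conjTranspose_mul_self {C A : Type} [Fintype C] [DecidableEq C]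
    [DecidableEq A] {f : T → C} (hf : Function.Injective f) (g : T → A) (z : T → ℂ) :
    (transfer f g z)ᴴ * transfer f g z
      = Matrix.diagonal fun a => ((∑ t, if g t = a then ‖z t‖ ^ 2 else 0 : ℝ) : ℂ) := by
  have hterm : ∀ t,
      ∑ t', Matrix.single (g t) (f t) (star (z t)) * Matrix.single (f t') (g t') (z t')
        = Matrix.single (g t) (g t) ((‖z t‖ ^ 2 : ℝ) : ℂ) := fun t => by
    rw [Fintype.sum_eq_single t fun t' ht =>
        Matrix.single_mul_single_of_ne _ _ _ _ (hf.ne ht.symm) _,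
      Matrix.single_mul_single_same, Complex.star_def, ← Complex.normSq_eq_conj_mul_self,
      Complex.normSq_eq_norm_sq]
  rw [transfer, Matrix.conjTranspose_sum, Matrix.sum_mul]
  simp only [Matrix.conjTranspose_single, Matrix.mul_sum, hterm]
  ext a b
  rw [Matrix.sum_apply, Matrix.diagonal_apply]
  split_ifs with hab
  · subst hab
    simp [Matrix.single_apply, apply_ite]
  · exact Finset.sum_eq_zero fun t _ =>
      Matrix.single_apply_of_ne (h := fun h => hab (h.1.symm.trans h.2)) ..

theorem dotProduct_transfer_kronecker_mulVec {A B A' B' : LocalSystem} (φ : Ket A B)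
    (ψ : Ket A' B') (f : T → A'.ι) (g : T → A.ι) (z : T → ℂ) (f' : T → B'.ι) (g' : T → B.ι)
    (z' : T → ℂ) :
    star ψ ⬝ᵥ ((transfer f g z ⊗ₖ transfer f' g' z') *ᵥ φ)
      = ∑ t, ∑ t', star (ψ (f t, f' t')) * (z t * z' t' * φ (g t, g' t')) := by
  have hkron : transfer f g z ⊗ₖ transfer f' g' z'
      = ∑ t, ∑ t', Matrix.single (f t, f' t') (g t, g' t') (z t * z' t') := by
    ext c a
    simp only [transfer, ← Matrix.single_kronecker_single, Matrix.kroneckerMap_apply,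
      Matrix.sum_apply, Finset.sum_mul_sum]
  have hsingle : ∀ c a w, star ψ ⬝ᵥ (Matrix.single c a w *ᵥ φ) = star (ψ c) * (w * φ a) :=
    fun c a w => by
      rw [Matrix.single_mulVec]
      exact dotProduct_single _ _ _
  simp only [hkron, Matrix.sum_mulVec, dotProduct_sum, hsingle]

theorem hasShift_transfer {A C : LocalSystem} {f : T → C.ι} {g : T → A.ι} (z : T → ℂ) {Δ : ℤ}
    (h : ∀ t, (C.num (f t) : ℤ) = A.num (g t) + Δ) : HasShift (transfer f g z) := by
  refine ⟨Δ, fun c a hca => ?_⟩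
  rw [transfer, Matrix.sum_apply] at hca
  obtain ⟨t, -, ht⟩ := Finset.exists_ne_zero_of_sum_ne_zero hca
  obtain ⟨rfl, rfl⟩ : f t = c ∧ g t = a := by
    by_contra hne
    exact ht (Matrix.single_apply_of_ne (h := hne) ..)
  exact h t

theorem isPartialMeasurement_transfer {J : Type} [Fintype J] {A C : LocalSystem} {f : T → C.ι}
    (hf : Function.Injective f) {g : J → T → A.ι} {z : J → T → ℂ} {Δ : ℤ}
    (hΔ : ∀ j t, (C.num (f t) : ℤ) = A.num (g j t) + Δ)
    (hz : ∀ a, ∑ j, ∑ t, (if g j t = a then ‖z j t‖ ^ 2 else 0) ≤ 1) :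
    IsPartialMeasurement fun j => (transfer f (g j) (z j) : Matrix C.ι A.ι ℂ) where
  hasShift j := hasShift_transfer (z j) (hΔ j)
  sum_eq := by
    refine ⟨_, hz, ?_⟩
    simp only [transfer_conjTranspose_mul_self hf, Complex.ofReal_sum]
    ext a b
    by_cases hab : a = b <;> simp [Matrix.sum_apply, hab]

end Transfer

section LabelPerm

variable {X L : Type}

/-- The permutations that preserve a labelling. -/
def labelPerm (s : X → L) : Subgroup (Equiv.Perm X) where
  carrier := {σ | ∀ x, s (σ x) = s x}
  one_mem' _ := rfl
  mul_mem' {_ τ} hσ hτ x := (hσ (τ x)).trans (hτ x)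
  inv_mem' {_} hσ x := (hσ _).symm.trans (congrArg s (Equiv.apply_symm_apply _ x))

noncomputable instance [Finite X] (s : X → L) : Fintype (labelPerm s) := Fintype.ofFinite _

theorem labelPerm_label_apply {s : X → L} (σ : labelPerm s) (x : X) : s (σ.1 x) = s x :=
  σ.2 x

/-- The number of elements with a given label. -/
noncomputable def blockCard (s : X → L) (n : L) : ℕ := Nat.card {x // s x = n}

theorem swap_mem_labelPerm [DecidableEq X] {s : X → L} {y z : X} (h : s y = s z) :
    Equiv.swap y z ∈ labelPerm s := fun w => by
  rcases eq_or_ne w y with rfl | hy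
  · rw [Equiv.swap_apply_left, h]
  rcases eq_or_ne w z with rfl | hz
  · rw [Equiv.swap_apply_right, h]
  · rw [Equiv.swap_apply_of_ne_of_ne hy hz]

theorem card_labelPerm_apply_eq_mul_blockCard [Finite X] [DecidableEq X] {s : X → L} {x y : X}
    (h : s x = s y) :
    Finset.card {σ : labelPerm s | σ.1 x = y} * blockCard s (s x)
      = Fintype.card (labelPerm s) := by
  classical
  have := Fintype.ofFinite X
  have hconst : ∀ z, s z = s x →
      Finset.card {σ : labelPerm s | σ.1 x = z} = Finset.card {σ : labelPerm s | σ.1 x = y} :=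
    fun z hz => Finset.card_equiv (Equiv.mulLeft ⟨_, swap_mem_labelPerm (h.symm.trans hz.symm)⟩)
      fun σ => by simp [Equiv.swap_apply_eq_iff]
  have hfiber := Finset.card_eq_sum_card_fiberwise (s := Finset.univ) (t := {z | s z = s x})
    (f := fun σ : labelPerm s => σ.1 x) fun σ _ => by simpa using labelPerm_label_apply σ x
  rw [← Finset.card_univ, hfiber, Finset.sum_congr rfl fun z hz =>
    hconst z (Finset.mem_filter.1 hz).2, Finset.sum_const, smul_eq_mul, mul_comm, blockCard,
    Nat.card_eq_fintype_card, Fintype.card_subtype]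

theorem sum_labelPerm_ite [Finite X] [DecidableEq X] [DecidableEq L] (s : X → L) (x y : X)
    (c : ℝ) :
    ∑ σ : labelPerm s, (if σ.1 x = y then
      blockCard s (s x) / Fintype.card (labelPerm s) * c else 0) = if s x = s y then c else 0 := by
  rw [← Finset.sum_filter, Finset.sum_const, nsmul_eq_mul]
  split_ifs with h
  · have hG : (Fintype.card (labelPerm s) : ℝ) ≠ 0 := Nat.cast_ne_zero.2 Fintype.card_ne_zero
    rw [← mul_assoc, ← mul_div_assoc, ← Nat.cast_mul, card_labelPerm_apply_eq_mul_blockCard h,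
      div_self hG, one_mul]
  · rw [Finset.filter_false_of_mem, Finset.card_empty, Nat.cast_zero, zero_mul]
    rintro σ - rfl
    exact h (labelPerm_label_apply σ x).symm

end LabelPerm

section BlockConversion

theorem mul_sqrt_div_mul {d : ℝ} (hd : 0 ≤ d) (a b : ℝ) : d * √(a / d * b) = √(a * d * b) := by
  rcases hd.eq_or_lt with rfl | hd
  · simp
  · rw [← Real.sqrt_sq hd.le, ← Real.sqrt_mul (sq_nonneg _), Real.sqrt_sq hd.le]
    congr 1
    field_simp

/-- A Schmidt decomposition of `φ` along basis vectors `alice x ⊗ bob x` of definite local particle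
numbers. The label `s x` is Alice's particle number up to a constant, and the squared modulus of
the Schmidt coefficient of `x` is `w (s x)`, so `φ` is maximally entangled within each block of
constant label. -/
structure SchmidtBlocks {A B : LocalSystem} (φ : Ket A B) {X : Type} (s : X → ℕ) (w : ℕ → ℝ) where
  alice : X ↪ A.ι
  bob : X ↪ B.ι
  shiftA : ℤ
  shiftB : ℤ
  num_alice : ∀ x, (A.num (alice x) : ℤ) = s x + shiftA
  num_bob : ∀ x, (B.num (bob x) : ℤ) = shiftB - s x
  support : ∀ a b, φ (a, b) ≠ 0 → ∃ x, alice x = a ∧ bob x = b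
  norm_sq : ∀ x, ‖φ (alice x, bob x)‖ ^ 2 = w (s x)

namespace SchmidtBlocks

variable {A B A' B' : LocalSystem} {φ : Ket A B} {ψ : Ket A' B'} {X Y T : Type}
  {s : X → ℕ} {s' : Y → ℕ} {f g : ℕ → ℝ}

theorem norm_eq (S : SchmidtBlocks φ s f) (x : X) : ‖φ (S.alice x, S.bob x)‖ = √(f (s x)) := by
  rw [← S.norm_sq, Real.sqrt_sq (norm_nonneg _)]

theorem eq_zero_of_ne (S : SchmidtBlocks φ s f) {x y : X} (hxy : x ≠ y) :
    φ (S.alice x, S.bob y) = 0 := by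
  by_contra hne
  obtain ⟨u, hux, huy⟩ := S.support _ _ hne
  exact hxy ((S.alice.injective hux).symm.trans (S.bob.injective huy))

/-- The share of the block of `x t` that Alice keeps when she maps it onto the block of `y t`,
divided equally between the outcomes of her measurement. -/
noncomputable def blockWeight [Finite X] (s : X → ℕ) (s' : Y → ℕ) (x : T → X) (y : T → Y)
    (t : T) : ℝ :=
  blockCard s (s (x t)) / Fintype.card (labelPerm s) * (1 / blockCard s' (s' (y t)))

theorem blockWeight_nonneg [Finite X] (x : T → X) (y : T → Y) (t : T) :
    0 ≤ blockWeight s s' x y t :=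
  mul_nonneg (by positivity) (by positivity)

theorem sum_blockWeight_le_one [Finite X] [DecidableEq X] [Finite Y] [Fintype T]
    (x : T ↪ X) (y : T ↪ Y) {Δ : ℤ} (hxy : ∀ t, (s' (y t) : ℤ) = s (x t) + Δ) (x₀ : X) :
    ∑ σ : labelPerm s, ∑ t, (if σ.1 (x t) = x₀ then blockWeight s s' x y t else 0) ≤ 1 := by
  classical
  have := Fintype.ofFinite Y
  rw [Finset.sum_comm]
  simp only [blockWeight, sum_labelPerm_ite]
  rw [← Finset.sum_filter]
  rcases Finset.eq_empty_or_nonempty ({t | s (x t) = s x₀} : Finset T) with hempty | ⟨t₀, ht₀⟩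
  · rw [hempty, Finset.sum_empty]
    exact zero_le_one
  have hlabel : ∀ t ∈ ({t | s (x t) = s x₀} : Finset T), s' (y t) = s' (y t₀) := fun t ht => by
    have h₀ : s (x t₀) = s x₀ := (Finset.mem_filter.1 ht₀).2
    have h : s (x t) = s x₀ := (Finset.mem_filter.1 ht).2
    have := hxy t
    have := hxy t₀
    omega
  have hcard : Finset.card {t | s (x t) = s x₀} ≤ blockCard s' (s' (y t₀)) := by
    rw [blockCard, Nat.card_eq_fintype_card, Fintype.card_subtype, ← Finset.card_map y]
    refine Finset.card_le_card fun z hz => ?_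
    obtain ⟨t, ht, rfl⟩ := Finset.mem_map.1 hz
    simpa using hlabel t ht
  rw [Finset.sum_congr rfl fun t ht => by rw [hlabel t ht], Finset.sum_const, nsmul_eq_mul,
    mul_one_div]
  exact div_le_one_of_le₀ (Nat.cast_le.2 hcard) (Nat.cast_nonneg _)

theorem isPartialMeasurement_alice [Finite X] [Finite Y] [Fintype T]
    (S : SchmidtBlocks φ s f) (S' : SchmidtBlocks ψ s' g) (x : T ↪ X) (y : T ↪ Y) {Δ : ℤ}
    (hxy : ∀ t, (s' (y t) : ℤ) = s (x t) + Δ) {z : labelPerm s → T → ℂ}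
    (hz : ∀ σ t, ‖z σ t‖ ^ 2 = blockWeight s s' x y t) :
    IsPartialMeasurement fun σ => transfer (S'.alice ∘ y) (S.alice ∘ σ.1 ∘ x) (z σ) := by
  classical
  refine isPartialMeasurement_transfer (S'.alice.injective.comp y.injective)
    (Δ := Δ + S'.shiftA - S.shiftA) (fun σ t => ?_) fun a => ?_
  · simp only [Function.comp_apply, S.num_alice, S'.num_alice, labelPerm_label_apply, hxy]
    ring
  · by_cases ha : ∃ x₀, S.alice x₀ = a
    · obtain ⟨x₀, rfl⟩ := ha
      simpa only [Function.comp_apply, S.alice.injective.eq_iff, hz] using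
        sum_blockWeight_le_one x y hxy x₀
    · exact (Finset.sum_nonpos fun σ _ => Finset.sum_nonpos fun t _ =>
        (if_neg fun h => ha ⟨_, h⟩).le).trans zero_le_one

theorem isPartialMeasurement_bob [Fintype T] (S : SchmidtBlocks φ s f) (S' : SchmidtBlocks ψ s' g)
    (x : T ↪ X) (y : T ↪ Y) {Δ : ℤ} (hxy : ∀ t, (s' (y t) : ℤ) = s (x t) + Δ) :
    IsPartialMeasurement fun _ : Unit => transfer (S'.bob ∘ y) (S.bob ∘ x) fun _ => 1 := by
  refine isPartialMeasurement_transfer (S'.bob.injective.comp y.injective)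
    (Δ := S'.shiftB - S.shiftB - Δ) (fun _ t => ?_) fun b => ?_
  · simp only [Function.comp_apply, S.num_bob, S'.num_bob, hxy]
    ring
  · rw [Fintype.sum_unique]
    simp only [Function.comp_apply, norm_one, one_pow, Finset.sum_boole]
    refine Nat.cast_le_one.2 (Finset.card_le_one.2 fun t ht t' ht' => ?_)
    exact (S.bob.injective.comp x.injective)
      ((Finset.mem_filter.1 ht).2.trans (Finset.mem_filter.1 ht').2.symm)

theorem dotProduct_transfer [Fintype T] (S : SchmidtBlocks φ s f) (S' : SchmidtBlocks ψ s' g)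
    (x : T → X) (y : T ↪ Y) (z : T → ℂ) :
    star ψ ⬝ᵥ ((transfer (S'.alice ∘ y) (S.alice ∘ x) z ⊗ₖ
        transfer (S'.bob ∘ y) (S.bob ∘ x) fun _ => 1) *ᵥ φ)
      = ∑ t, z t * (star (ψ (S'.alice (y t), S'.bob (y t))) * φ (S.alice (x t), S.bob (x t))) := by
  rw [dotProduct_transfer_kronecker_mulVec]
  refine Finset.sum_congr rfl fun t _ => ?_
  rw [Fintype.sum_eq_single t fun t' ht' => ?_]
  · simp only [Function.comp_apply]
    ring
  · simp [S'.eq_zero_of_ne (y.injective.ne ht'.symm)]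

theorem sqrt_blockWeight_mul [Finite X] (S : SchmidtBlocks φ s f) (x : T → X) (y : T → Y) (t : T) :
    √(blockWeight s s' x y t) * (√(f (s (x t))) * √(g (s' (y t))))
      = √(blockCard s (s (x t)) / blockCard s' (s' (y t)) * (f (s (x t)) * g (s' (y t))))
        / √(Fintype.card (labelPerm s)) := by
  have hf : 0 ≤ f (s (x t)) := S.norm_sq (x t) ▸ sq_nonneg _
  rw [← Real.sqrt_mul hf, ← Real.sqrt_mul (blockWeight_nonneg x y t),
    ← Real.sqrt_div' _ (Nat.cast_nonneg _), blockWeight]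
  congr 1
  ring

/-- Alice applies a random permutation within the blocks, which makes her operation a measurement,
and both parties map `x t` to `y t`, Alice adjusting the Schmidt coefficients and the phases. -/
theorem reachesFidelity_of_matching [Finite X] [Finite Y] [Nonempty Y] [Fintype T]
    (S : SchmidtBlocks φ s f) (S' : SchmidtBlocks ψ s' g) (x : T ↪ X) (y : T ↪ Y) {Δ : ℤ}
    (hxy : ∀ t, (s' (y t) : ℤ) = s (x t) + Δ) :
    ReachesFidelity φ ψ ((∑ t, √(blockCard s (s (x t)) / blockCard s' (s' (y t))
      * (f (s (x t)) * g (s' (y t))))) ^ 2) := by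
  classical
  have : Nonempty A'.ι := Nonempty.map S'.alice ‹_›
  have : Nonempty B'.ι := Nonempty.map S'.bob ‹_›
  have hphase : ∀ (σ : labelPerm s) t, ∃ c : ℂ, ‖c‖ = 1 ∧
      c * (star (ψ (S'.alice (y t), S'.bob (y t))) * φ (S.alice (σ.1 (x t)), S.bob (σ.1 (x t))))
        = (√(f (s (x t))) * √(g (s' (y t))) : ℝ) := fun σ t => by
    obtain ⟨c, hc, h⟩ := Complex.exists_norm_eq_mul_self
      (star (ψ (S'.alice (y t), S'.bob (y t))) * φ (S.alice (σ.1 (x t)), S.bob (σ.1 (x t))))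
    rw [norm_mul, norm_star, S.norm_eq, S'.norm_eq, labelPerm_label_apply σ, mul_comm √_] at h
    exact ⟨c, hc, h.symm⟩
  choose c hc hcmul using hphase
  have hz : ∀ σ t, ‖(√(blockWeight s s' x y t) : ℂ) * c σ t‖ ^ 2 = blockWeight s s' x y t :=
    fun σ t => by
      rw [norm_mul, hc, mul_one, Complex.norm_real, Real.norm_eq_abs, sq_abs,
        Real.sq_sqrt (blockWeight_nonneg x y t)]
  have hK := S.isPartialMeasurement_alice S' x y hxy hz
  have hU : ∀ σ : labelPerm s, IsPartialMeasurement fun _ : Unit =>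
      transfer (S'.bob ∘ y) (S.bob ∘ σ.1 ∘ x) fun _ => 1 := fun σ =>
    S.isPartialMeasurement_bob S' (x.trans σ.1.toEmbedding) y fun t => by
      simpa [labelPerm_label_apply σ] using hxy t
  refine (hK.reachesFidelity_oneWay (φ := φ) (ψ := ψ) hU).mono (le_of_eq ?_)
  simp only [S.dotProduct_transfer S', Function.comp_apply, mul_assoc, hcmul, ← Complex.ofReal_mul,
    S.sqrt_blockWeight_mul, ← Complex.ofReal_sum, ← Finset.sum_div, Complex.norm_real,
    Real.norm_eq_abs, sq_abs, Finset.sum_const, Finset.card_univ, nsmul_eq_mul, div_pow,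
    Real.sq_sqrt (Nat.cast_nonneg _)]
  have hG : (Fintype.card (labelPerm s) : ℝ) ≠ 0 := Nat.cast_ne_zero.2 Fintype.card_ne_zero
  exact (mul_div_cancel_left₀ _ hG).symm

theorem exists_blockEmbedding [Finite X] [Finite Y] {n m : ℕ} {Z : Finset ℕ}
    (hcard : ∀ k ∈ Z, blockCard s' (m + k) ≤ blockCard s (n + k)) :
    ∃ x : (Σ k : Z, {y // s' y = m + k}) ↪ X, ∀ t, s (x t) = n + t.1 := by
  have hemb : ∀ k : Z, Nonempty ({y // s' y = m + k} ↪ {x // s x = n + k}) := fun k => by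
    have := Fintype.ofFinite {y // s' y = m + k}
    have := Fintype.ofFinite {x // s x = n + k}
    exact Function.Embedding.nonempty_of_card_le <| by
      simpa only [blockCard, Nat.card_eq_fintype_card] using hcard k k.2
  let e := fun k => (hemb k).some
  refine ⟨⟨fun t => (e t.1 t.2).1, ?_⟩, fun t => (e t.1 t.2).2⟩
  rintro ⟨k, u⟩ ⟨k', u'⟩ (hx : (e k u).1 = (e k' u').1)
  have hk := (e k u).2
  have hk' := (e k' u').2
  obtain rfl : k = k' := Subtype.ext (by rw [hx] at hk; omega)
  obtain rfl : u = u' := (e k).injective (Subtype.ext hx)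
  rfl

theorem converts_of_blockCard_le [Finite X] [Finite Y] [Nonempty Y]
    (S : SchmidtBlocks φ s f) (S' : SchmidtBlocks ψ s' g) {ε : ℝ} {n m : ℕ} {Z : Finset ℕ}
    (hcard : ∀ k ∈ Z, blockCard s' (m + k) ≤ blockCard s (n + k))
    (h : 1 - ε ≤ (∑ k ∈ Z, √((blockCard s (n + k) * f (n + k)) *
      (blockCard s' (m + k) * g (m + k)))) ^ 2) : Converts φ ψ ε := by
  have := Fintype.ofFinite Y
  obtain ⟨x, hx⟩ := exists_blockEmbedding hcard
  obtain ⟨y, hy⟩ := exists_blockEmbedding (s := s') (Z := Z) fun k _ =>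
    le_refl (blockCard s' (m + k))
  refine (S.reachesFidelity_of_matching S' x y (Δ := m - n) fun t => ?_).mono
    (h.trans (le_of_eq (Eq.symm ?_)))
  · rw [hx, hy]
    push_cast
    ring
  · simp only [hx, hy]
    rw [Fintype.sum_sigma, ← Finset.sum_coe_sort Z]
    refine congrArg (· ^ 2) (Finset.sum_congr rfl fun k _ => ?_)
    dsimp only
    rw [Finset.sum_const, nsmul_eq_mul, Finset.card_univ, ← Nat.card_eq_fintype_card, ← blockCard,
      mul_sqrt_div_mul (Nat.cast_nonneg _), mul_mul_mul_comm]

end SchmidtBlocks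

end BlockConversion

section States

namespace SchmidtBlocks

theorem support_pow {A B : LocalSystem} {φ : Ket A B} {N : ℕ} {a : Fin N → A.ι} {b : Fin N → B.ι}
    (h : φ.pow N (a, b) ≠ 0) (k : Fin N) : φ (a k, b k) ≠ 0 :=
  Finset.prod_ne_zero_iff.1 h k (Finset.mem_univ k)

theorem norm_sq_pow {A B : LocalSystem} (φ : Ket A B) {N : ℕ} (a : Fin N → A.ι) (b : Fin N → B.ι) :
    ‖φ.pow N (a, b)‖ ^ 2 = ∏ k, ‖φ (a k, b k)‖ ^ 2 := by
  rw [Ket.pow, norm_prod, Finset.prod_pow]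

/-- `N` copies of a maximally entangled state, with the one label `0`, are a single block again. -/
def powFlat {A B : LocalSystem} {φ : Ket A B} {X : Type} {c : ℝ}
    (S : SchmidtBlocks φ (fun _ : X => 0) fun _ => c) (N : ℕ) :
    SchmidtBlocks (φ.pow N) (fun _ : Fin N → X => 0) fun _ => c ^ N where
  alice := S.alice.arrowCongrRight
  bob := S.bob.arrowCongrRight
  shiftA := N * S.shiftA
  shiftB := N * S.shiftB
  num_alice x := by simp [S.num_alice]
  num_bob x := by simp [S.num_bob]
  support a b h := by
    choose x hxa hxb using fun k => S.support _ _ (support_pow h k)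
    exact ⟨x, funext hxa, funext hxb⟩
  norm_sq x := by
    rw [norm_sq_pow]
    exact (Finset.prod_congr rfl fun k _ => S.norm_sq (x k)).trans (by simp)

/-- Adjoining a maximally entangled state, all of whose Schmidt vectors have the label `0`, enlarges
every block by the same factor. -/
def tensorFlat {A₁ B₁ A₂ B₂ : LocalSystem} {φ₁ : Ket A₁ B₁} {φ₂ : Ket A₂ B₂} {X₁ X₂ : Type}
    {s : X₂ → ℕ} {c : ℝ} {f : ℕ → ℝ} (S₁ : SchmidtBlocks φ₁ (fun _ : X₁ => 0) fun _ => c)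
    (S₂ : SchmidtBlocks φ₂ s f) :
    SchmidtBlocks (φ₁.tensor φ₂) (fun x : X₁ × X₂ => s x.2) fun n => c * f n where
  alice := S₁.alice.prodMap S₂.alice
  bob := S₁.bob.prodMap S₂.bob
  shiftA := S₁.shiftA + S₂.shiftA
  shiftB := S₁.shiftB + S₂.shiftB
  num_alice x := by
    have h₁ := S₁.num_alice x.1
    have h₂ := S₂.num_alice x.2
    simp only [Function.Embedding.coe_prodMap, Prod.map]
    push_cast at *
    linarith
  num_bob x := by
    have h₁ := S₁.num_bob x.1
    have h₂ := S₂.num_bob x.2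
    simp only [Function.Embedding.coe_prodMap, Prod.map]
    push_cast at *
    linarith
  support := by
    rintro ⟨a₁, a₂⟩ ⟨b₁, b₂⟩ h
    obtain ⟨x₁, rfl, rfl⟩ := S₁.support a₁ b₁ (left_ne_zero_of_mul h)
    obtain ⟨x₂, rfl, rfl⟩ := S₂.support a₂ b₂ (right_ne_zero_of_mul h)
    exact ⟨(x₁, x₂), rfl, rfl⟩
  norm_sq x := by
    have h₁ := S₁.norm_sq x.1
    have h₂ := S₂.norm_sq x.2
    exact (congrArg (· ^ 2) (norm_mul _ _)).trans ((mul_pow _ _ 2).trans (congrArg₂ _ h₁ h₂))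

/-- A product of two basis vectors, as a block with one element. -/
def single {A B : LocalSystem} {φ : Ket A B} {a₀ : A.ι} {b₀ : B.ι}
    (hsupp : ∀ a b, φ (a, b) ≠ 0 → a = a₀ ∧ b = b₀) :
    SchmidtBlocks φ (fun _ : Unit => 0) fun _ => ‖φ (a₀, b₀)‖ ^ 2 where
  alice := ⟨fun _ => a₀, fun _ _ _ => rfl⟩
  bob := ⟨fun _ => b₀, fun _ _ _ => rfl⟩
  shiftA := A.num a₀
  shiftB := B.num b₀
  num_alice _ := (zero_add (A.num a₀ : ℤ)).symm
  num_bob _ := (sub_zero (B.num b₀ : ℤ)).symm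
  support a b h := ⟨(), (hsupp a b h).1.symm, (hsupp a b h).2.symm⟩
  norm_sq _ := rfl

end SchmidtBlocks

/-- E-EPR as a single maximally entangled block: both its terms have one particle on each side. -/
noncomputable def eEPRBlocks : SchmidtBlocks eEPR (fun _ : Fin 2 => 0) fun _ => 1 / 2 where
  alice := ⟨fun x => (x, 1 - x), fun _ _ h => congrArg Prod.fst h⟩
  bob := ⟨fun x => (1 - x, x), fun _ _ h => congrArg Prod.snd h⟩
  shiftA := 1
  shiftB := 1
  num_alice := by decide
  num_bob := by decide
  support a b h := by
    have hab : (a, b) = ((0, 1), (1, 0)) ∨ (a, b) = ((1, 0), (0, 1)) := by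
      by_contra hne
      exact h (if_neg hne)
    rcases hab with hab | hab <;> obtain ⟨rfl, rfl⟩ := Prod.mk.inj hab
    exacts [⟨0, rfl, rfl⟩, ⟨1, rfl, rfl⟩]
  norm_sq x := by
    have hsq : ‖((Real.sqrt 2 : ℝ) : ℂ)⁻¹‖ ^ 2 = 1 / 2 := by simp
    fin_cases x
    exacts [hsq ▸ congrArg (‖·‖ ^ 2) (if_pos (Or.inl rfl)),
      hsq ▸ congrArg (‖·‖ ^ 2) (if_pos (Or.inr rfl))]

/-- Exactly one of the two modes is occupied, Alice's with probability `p` and Bob's with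
probability `1 - p`. -/
structure IsAnticorrelated (φ : Ket qubit qubit) (p : ℝ) : Prop where
  eq_zero_zero : φ (0, 0) = 0
  eq_one_one : φ (1, 1) = 0
  norm_sq_alice : ‖φ (1, 0)‖ ^ 2 = p
  norm_sq_bob : ‖φ (0, 1)‖ ^ 2 = 1 - p

/-- The basis state of `N` modes with mode `k` in state `i` for `k ∈ S` and in state `j`
otherwise. -/
def twoValued (N : ℕ) {i j : Fin 2} (hij : i ≠ j) : Finset (Fin N) ↪ (Fin N → Fin 2) where
  toFun S k := if k ∈ S then i else j
  inj' S S' hS := by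
    ext k
    have hk : (if k ∈ S then i else j) = if k ∈ S' then i else j := congrFun hS k
    by_cases h : k ∈ S <;> by_cases h' : k ∈ S' <;> simp_all

@[simp]
theorem twoValued_apply {N : ℕ} {i j : Fin 2} (hij : i ≠ j) (S : Finset (Fin N)) (k : Fin N) :
    twoValued N hij S k = if k ∈ S then i else j :=
  rfl

namespace IsAnticorrelated

variable {φ : Ket qubit qubit} {p : ℝ}

theorem eq_or_eq_of_ne_zero (h : IsAnticorrelated φ p) {i j : Fin 2} (hij : φ (i, j) ≠ 0) :
    i = 0 ∧ j = 1 ∨ i = 1 ∧ j = 0 := by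
  fin_cases i <;> fin_cases j <;> simp_all [h.eq_zero_zero, h.eq_one_one]

theorem norm_sq_ite (h : IsAnticorrelated φ p) (P : Prop) [Decidable P] :
    ‖φ (if P then 1 else 0, if P then 0 else 1)‖ ^ 2 = if P then p else 1 - p := by
  split_ifs
  exacts [h.norm_sq_alice, h.norm_sq_bob]

/-- The Schmidt basis of `φ^⊗N` is indexed by the set of Alice's occupied modes. -/
noncomputable def blocksPow (h : IsAnticorrelated φ p) (N : ℕ) :
    SchmidtBlocks (φ.pow N) (Finset.card : Finset (Fin N) → ℕ)
      fun n => p ^ n * (1 - p) ^ (N - n) where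
  alice := twoValued N one_ne_zero
  bob := twoValued N zero_ne_one
  shiftA := 0
  shiftB := N
  num_alice S := by simp [apply_ite]
  num_bob S := by
    have hS : S.card ≤ N := by simpa using S.card_le_univ
    simp [apply_ite, Finset.sum_ite, Finset.filter_not, ← Finset.compl_eq_univ_sdiff,
      Finset.card_compl, hS]
  support a b hab := by
    refine ⟨({k | a k = 1} : Finset (Fin N)), funext fun k => ?_, funext fun k => ?_⟩ <;>
      rcases h.eq_or_eq_of_ne_zero (SchmidtBlocks.support_pow hab k) with ⟨ha, hb⟩ | ⟨ha, hb⟩ <;>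
      simp [ha, hb]
  norm_sq S := by
    rw [SchmidtBlocks.norm_sq_pow]
    simp only [twoValued_apply, h.norm_sq_ite, Finset.prod_ite, Finset.prod_const,
      Finset.filter_univ_mem, Finset.filter_not, ← Finset.compl_eq_univ_sdiff, Finset.card_compl,
      Fintype.card_fin]

end IsAnticorrelated

theorem isAnticorrelated_vEPR : IsAnticorrelated vEPR (1 / 2) where
  eq_zero_zero := by simp [vEPR]
  eq_one_one := by simp [vEPR]
  norm_sq_alice := by simp [vEPR]
  norm_sq_bob := by norm_num [vEPR]

theorem blockCard_finsetCard (N n : ℕ) :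
    blockCard (Finset.card : Finset (Fin N) → ℕ) n = N.choose n := by
  rw [blockCard, Nat.card_eq_fintype_card, Fintype.card_finset_len, Fintype.card_fin]

theorem blockCard_snd {X Y : Type} (s : Y → ℕ) (n : ℕ) :
    blockCard (fun x : X × Y => s x.2) n = Nat.card X * blockCard s n := by
  rw [blockCard, blockCard, ← Nat.card_prod]
  exact Nat.card_congr
    { toFun := fun x => (x.1.1, ⟨x.1.2, x.2⟩)
      invFun := fun x => ⟨(x.1, x.2.1), x.2.2⟩ }

/-- The resource state of `e` copies of E-EPR and `v` copies of V-EPR. -/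
noncomputable abbrev eprPairs (e v : ℕ) :
    Ket (((qubit.tensor qubit).pow e).tensor (qubit.pow v))
      (((qubit.tensor qubit).pow e).tensor (qubit.pow v)) :=
  (eEPR.pow e).tensor (vEPR.pow v)

/-- The blocks of `eprPairs e v`: the label is the number of V-EPR copies whose particle Alice
holds, and E-EPR contributes only to the size of the blocks. -/
noncomputable def eprBlocks (e v : ℕ) :
    SchmidtBlocks (eprPairs e v)
      (fun y : (Fin e → Fin 2) × Finset (Fin v) => y.2.card)
      fun m => (1 / 2) ^ e * ((1 / 2) ^ m * (1 - 1 / 2) ^ (v - m)) :=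
  (eEPRBlocks.powFlat e).tensorFlat (isAnticorrelated_vEPR.blocksPow v)

theorem blockCard_epr (e v m : ℕ) :
    blockCard (fun y : (Fin e → Fin 2) × Finset (Fin v) => y.2.card) m = 2 ^ e * v.choose m := by
  rw [blockCard_snd, blockCard_finsetCard]
  simp

theorem blockCard_epr_mul (e v m : ℕ) :
    blockCard (fun y : (Fin e → Fin 2) × Finset (Fin v) => y.2.card) m *
      ((1 / 2) ^ e * ((1 / 2) ^ m * (1 - 1 / 2) ^ (v - m))) = binomialProb v (1 / 2) m := by
  have h : (2 : ℝ) ^ e * (1 / 2) ^ e = 1 := by rw [← mul_pow]; norm_num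
  rw [blockCard_epr, binomialProb]
  push_cast
  linear_combination (v.choose m : ℝ) * ((1 / 2) ^ m * (1 - 1 / 2) ^ (v - m)) * h

end States

section Marginals

variable {A B : LocalSystem}

/-- The probability of finding Alice's system in the basis state `a`. -/
noncomputable def marginalA (φ : Ket A B) (a : A.ι) : ℝ :=
  ∑ b, ‖φ (a, b)‖ ^ 2

theorem sum_marginalA {φ : Ket A B} (hφ : IsPureState φ) : ∑ a, marginalA φ a = 1 := by
  rw [← hφ.1, Fintype.sum_prod_type]
  rfl

theorem marginalA_nonneg (φ : Ket A B) (a : A.ι) : 0 ≤ marginalA φ a :=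
  Finset.sum_nonneg fun _ _ => sq_nonneg _

theorem IsPureState.marginalA_le_one {φ : Ket A B} (hφ : IsPureState φ) (a : A.ι) :
    marginalA φ a ≤ 1 :=
  sum_marginalA hφ ▸ Finset.single_le_sum (fun a _ => marginalA_nonneg φ a) (Finset.mem_univ a)

theorem marginalA_ne_zero_iff {φ : Ket A B} {a : A.ι} :
    marginalA φ a ≠ 0 ↔ ∃ b, φ (a, b) ≠ 0 := by
  rw [marginalA, Ne, Finset.sum_eq_zero_iff_of_nonneg fun _ _ => sq_nonneg _]
  simp

theorem IsPureState.bob_eq {φ : Ket A B} (hφ : IsPureState φ) (hB : Function.Injective B.num)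
    {a : A.ι} {b b' : B.ι} (h : φ (a, b) ≠ 0) (h' : φ (a, b') ≠ 0) : b = b' := by
  obtain ⟨n, hn⟩ := hφ.2
  exact hB (Nat.add_left_cancel ((hn a b h).trans (hn a b' h').symm))

theorem IsPureState.alice_eq {φ : Ket A B} (hφ : IsPureState φ) (hA : Function.Injective A.num)
    {a a' : A.ι} {b : B.ι} (h : φ (a, b) ≠ 0) (h' : φ (a', b) ≠ 0) : a = a' := by
  obtain ⟨n, hn⟩ := hφ.2
  exact hA (Nat.add_right_cancel ((hn a b h).trans (hn a' b h').symm))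

theorem IsPureState.reducedA_eq_diagonal {φ : Ket A B} (hφ : IsPureState φ)
    (hA : Function.Injective A.num) :
    φ.reducedA = Matrix.diagonal fun a => (marginalA φ a : ℂ) := by
  ext a a'
  simp only [Ket.reducedA, Ket.proj, Matrix.of_apply, Matrix.vecMulVec_apply, Pi.star_apply]
  rcases eq_or_ne a a' with rfl | hne
  · rw [Matrix.diagonal_apply_eq, marginalA]
    push_cast
    exact Finset.sum_congr rfl fun b _ => Complex.mul_conj' _
  · rw [Matrix.diagonal_apply_ne _ hne]
    refine Finset.sum_eq_zero fun b _ => ?_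
    by_contra h
    exact hne (hφ.alice_eq hA (left_ne_zero_of_mul h) (star_ne_zero.1 (right_ne_zero_of_mul h)))

theorem sum_eigenvalues_of_eq_diagonal {ι : Type*} [Fintype ι] [DecidableEq ι]
    {M : Matrix ι ι ℂ} (hM : M.IsHermitian) {d : ι → ℝ}
    (h : M = Matrix.diagonal fun i => (d i : ℂ)) (F : ℝ → ℝ) :
    ∑ i, F (hM.eigenvalues i) = ∑ i, F (d i) := by
  have hroots : M.charpoly.roots = Finset.univ.val.map fun i => (d i : ℂ) := by
    rw [h, Matrix.charpoly_diagonal, Polynomial.roots_prod]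
    · simp
    · simp [Finset.prod_ne_zero_iff, Polynomial.X_sub_C_ne_zero]
  have hmap := congrArg (fun s => (s.map fun z : ℂ => F z.re).sum)
    (hroots.symm.trans hM.roots_charpoly_eq_eigenvalues)
  simpa [Multiset.map_map, Function.comp_def] using hmap.symm

theorem IsPureState.entanglement_eq_sum {φ : Ket A B} (hφ : IsPureState φ)
    (hA : Function.Injective A.num) :
    φ.entanglement = (∑ a, Real.negMulLog (marginalA φ a)) / Real.log 2 := by
  rw [Ket.entanglement, sum_eigenvalues_of_eq_diagonal _ (hφ.reducedA_eq_diagonal hA)]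

theorem expect_diagonal_kronecker_one (φ : Ket A B) (d : A.ι → ℝ) :
    φ.expect (Matrix.diagonal (fun a => (d a : ℂ)) ⊗ₖ (1 : Matrix B.ι B.ι ℂ)) =
      ∑ a, d a * marginalA φ a := by
  rw [Ket.expect, ← Matrix.diagonal_one, Matrix.diagonal_kronecker_diagonal, dotProduct,
    Complex.re_sum, Fintype.sum_prod_type]
  refine Finset.sum_congr rfl fun a _ => ?_
  rw [marginalA, Finset.mul_sum]
  refine Finset.sum_congr rfl fun b _ => ?_
  have hsq : star (φ (a, b)) * φ (a, b) = ((‖φ (a, b)‖ ^ 2 : ℝ) : ℂ) := by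
    rw [Complex.ofReal_pow]
    exact Complex.conj_mul' _
  rw [Matrix.mulVec_diagonal, Pi.star_apply, mul_one, mul_left_comm, hsq, ← Complex.ofReal_mul,
    Complex.ofReal_re]

theorem siv_eq_sum (φ : Ket A B) :
    φ.siv = 4 * (∑ a, (A.num a : ℝ) ^ 2 * marginalA φ a -
      (∑ a, (A.num a : ℝ) * marginalA φ a) ^ 2) := by
  have hsq : numA A B * numA A B =
      Matrix.diagonal (fun a => (((A.num a : ℝ) ^ 2 : ℝ) : ℂ)) ⊗ₖ (1 : Matrix B.ι B.ι ℂ) := by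
    rw [numA, ← Matrix.mul_kronecker_mul, Matrix.diagonal_mul_diagonal, Matrix.one_mul]
    simp [sq]
  have hnum : φ.expect (numA A B) = ∑ a, (A.num a : ℝ) * marginalA φ a := by
    simpa [numA] using expect_diagonal_kronecker_one φ fun a => (A.num a : ℝ)
  rw [Ket.siv, hsq, hnum, expect_diagonal_kronecker_one]

theorem IsPureState.exists_support_subset_single {φ : Ket A B} (hφ : IsPureState φ)
    (hB : Function.Injective B.num) {a₀ : A.ι} (h : ∀ a, a ≠ a₀ → marginalA φ a = 0) :
    ∃ b₀, ∀ a b, φ (a, b) ≠ 0 → a = a₀ ∧ b = b₀ := by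
  have hone : marginalA φ a₀ = 1 := by
    rw [← sum_marginalA hφ, Fintype.sum_eq_single a₀ h]
  obtain ⟨b₀, hb₀⟩ := marginalA_ne_zero_iff.1 (hone ▸ one_ne_zero)
  refine ⟨b₀, fun a b hab => ?_⟩
  obtain rfl : a = a₀ := by_contra fun ha => marginalA_ne_zero_iff.2 ⟨b, hab⟩ (h a ha)
  exact ⟨rfl, hφ.bob_eq hB hab hb₀⟩

theorem IsPureState.norm_sq_eq_one {φ : Ket A B} (hφ : IsPureState φ) {a₀ : A.ι} {b₀ : B.ι}
    (h : ∀ a b, φ (a, b) ≠ 0 → a = a₀ ∧ b = b₀) : ‖φ (a₀, b₀)‖ ^ 2 = 1 := by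
  rw [← hφ.1, Fintype.sum_eq_single (a₀, b₀)]
  rintro ⟨a, b⟩ hne
  by_contra hab
  obtain ⟨rfl, rfl⟩ := h a b fun h0 => hab (by rw [h0, norm_zero, zero_pow two_ne_zero])
  exact hne rfl

end Marginals

section Qubits

theorem injective_num_qubit : Function.Injective qubit.num :=
  Fin.val_injective

variable {φ : Ket qubit qubit}

theorem IsPureState.marginalA_zero (hφ : IsPureState φ) :
    marginalA φ (0 : Fin 2) = 1 - marginalA φ (1 : Fin 2) := by
  rw [← sum_marginalA hφ]
  exact eq_sub_of_add_eq (Fin.sum_univ_two _).symm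

theorem IsPureState.entanglement_eq (hφ : IsPureState φ) :
    φ.entanglement = Real.binEntropy (marginalA φ (1 : Fin 2)) / Real.log 2 := by
  rw [hφ.entanglement_eq_sum injective_num_qubit,
    Real.binEntropy_eq_negMulLog_add_negMulLog_one_sub, ← hφ.marginalA_zero]
  exact congrArg (· / _) ((Fin.sum_univ_two _).trans (add_comm _ _))

theorem siv_eq (φ : Ket qubit qubit) :
    φ.siv = 4 * (marginalA φ (1 : Fin 2) * (1 - marginalA φ (1 : Fin 2))) := by
  rw [siv_eq_sum]
  simp only [Fin.sum_univ_two, Fin.val_zero, Fin.val_one, Nat.cast_zero, Nat.cast_one]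
  ring

theorem IsPureState.isAnticorrelated (hφ : IsPureState φ) (h0 : 0 < marginalA φ (1 : Fin 2))
    (h1 : marginalA φ (1 : Fin 2) < 1) : IsAnticorrelated φ (marginalA φ (1 : Fin 2)) := by
  obtain ⟨b₁, hb₁⟩ := marginalA_ne_zero_iff.1 h0.ne'
  obtain ⟨b₀, hb₀⟩ := marginalA_ne_zero_iff.1 (hφ.marginalA_zero.trans_ne (sub_pos.2 h1).ne')
  obtain ⟨n, hn⟩ := hφ.2
  obtain rfl : 1 = n := by
    have h₀ : 0 + (b₀ : ℕ) = n := hn _ _ hb₀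
    have h₁ : 1 + (b₁ : ℕ) = n := hn _ _ hb₁
    have := b₀.isLt
    omega
  have hzero : φ (0, 0) = 0 := by_contra fun h => absurd (hn _ _ h) (by decide)
  have hone : φ (1, 1) = 0 := by_contra fun h => absurd (hn _ _ h) (by decide)
  refine ⟨hzero, hone, ?_, ?_⟩
  · simp [marginalA, Fin.sum_univ_two, hone]
  · rw [← hφ.marginalA_zero]
    simp [marginalA, Fin.sum_univ_two, hzero]

end Qubits

section Counting

open Real

theorem pow_mul_pow_eq_exp {p : ℝ} (h0 : 0 < p) (h1 : p < 1) {N n : ℕ} (h : n ≤ N) :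
    p ^ n * (1 - p) ^ (N - n) =
      exp (-(N * binEntropy p) + (n - N * p) * (log p - log (1 - p))) := by
  have hq : 0 < 1 - p := sub_pos.2 h1
  rw [← exp_log (mul_pos (pow_pos h0 n) (pow_pos hq (N - n))), log_mul (pow_pos h0 _).ne'
    (pow_pos hq _).ne', log_pow, log_pow, Nat.cast_sub h, binEntropy, log_inv, log_inv]
  ring_nf

theorem two_pow_eq_exp (j : ℕ) : (2 : ℝ) ^ j = exp (j * log 2) := by
  rw [exp_nat_mul, exp_log two_pos]

theorem two_pow_mul_pow_mul_pow_le {p r : ℝ} (h0 : 0 < p) (h1 : p < 1) {N n j : ℕ} (hn : n ≤ N)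
    (hr : |n - N * p| ≤ r)
    (hj : (j + 1) * log 2 + r * |log p - log (1 - p)| ≤ N * binEntropy p) :
    2 ^ j * (p ^ n * (1 - p) ^ (N - n)) ≤ 1 / 2 := by
  have hdev : (n - N * p) * (log p - log (1 - p)) ≤ r * |log p - log (1 - p)| :=
    (le_abs_self _).trans ((abs_mul _ _).trans_le (mul_le_mul_of_nonneg_right hr (abs_nonneg _)))
  rw [pow_mul_pow_eq_exp h0 h1 hn, two_pow_eq_exp, ← exp_add, one_div, ← exp_log two_pos,
    ← exp_neg, exp_le_exp, log_exp]
  linarith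

theorem two_le_two_pow_mul_pow_mul_pow {p r : ℝ} (h0 : 0 < p) (h1 : p < 1) {N n j : ℕ}
    (hn : n ≤ N) (hr : |n - N * p| ≤ r)
    (hj : N * binEntropy p + r * |log p - log (1 - p)| + log 2 ≤ j * log 2) :
    2 ≤ 2 ^ j * (p ^ n * (1 - p) ^ (N - n)) := by
  have hdev : -(r * |log p - log (1 - p)|) ≤ (n - N * p) * (log p - log (1 - p)) :=
    neg_le_of_neg_le ((neg_le_abs _).trans
      ((abs_mul _ _).trans_le (mul_le_mul_of_nonneg_right hr (abs_nonneg _))))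
  rw [pow_mul_pow_eq_exp h0 h1 hn, two_pow_eq_exp, ← exp_add]
  calc (2 : ℝ) = exp (log 2) := (exp_log two_pos).symm
    _ ≤ _ := exp_le_exp.2 (by linarith)

theorem choose_eq_two_pow_mul_binomialProb_half {v m : ℕ} (h : m ≤ v) :
    (v.choose m : ℝ) = 2 ^ v * binomialProb v (1 / 2) m := by
  rw [binomialProb, sub_half, ← pow_add, Nat.add_sub_cancel' h, mul_left_comm, ← mul_pow]
  norm_num

theorem two_pow_mul_choose_le_choose {p : ℝ} (h0 : 0 < p) (h1 : p < 1) {N n v m e : ℕ}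
    (hm : m ≤ v) (hQ : 1 / 2 * binomialProb v (1 / 2) m ≤ binomialProb N p n)
    (hw : 2 ^ (e + v) * (p ^ n * (1 - p) ^ (N - n)) ≤ 1 / 2) :
    2 ^ e * v.choose m ≤ N.choose n := by
  have hw0 : 0 < p ^ n * (1 - p) ^ (N - n) := mul_pos (pow_pos h0 _) (pow_pos (sub_pos.2 h1) _)
  suffices (2 : ℝ) ^ e * v.choose m ≤ N.choose n by exact_mod_cast this
  refine le_of_mul_le_mul_right ?_ hw0
  calc (2 : ℝ) ^ e * v.choose m * (p ^ n * (1 - p) ^ (N - n))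
      = 2 ^ (e + v) * (p ^ n * (1 - p) ^ (N - n)) * binomialProb v (1 / 2) m := by
        rw [choose_eq_two_pow_mul_binomialProb_half hm, pow_add]; ring
    _ ≤ 1 / 2 * binomialProb v (1 / 2) m :=
        mul_le_mul_of_nonneg_right hw (binomialProb_nonneg (by norm_num) (by norm_num) v m)
    _ ≤ N.choose n * (p ^ n * (1 - p) ^ (N - n)) := hQ

theorem choose_le_two_pow_mul_choose {p : ℝ} (h0 : 0 < p) (h1 : p < 1) {N n v m e : ℕ}
    (hm : m ≤ v) (hP : 1 / 2 * binomialProb N p n ≤ binomialProb v (1 / 2) m)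
    (hw : 2 ≤ 2 ^ (e + v) * (p ^ n * (1 - p) ^ (N - n))) :
    N.choose n ≤ 2 ^ e * v.choose m := by
  have hw0 : 0 < p ^ n * (1 - p) ^ (N - n) := mul_pos (pow_pos h0 _) (pow_pos (sub_pos.2 h1) _)
  suffices (N.choose n : ℝ) ≤ 2 ^ e * v.choose m by exact_mod_cast this
  refine le_of_mul_le_mul_right ?_ hw0
  calc N.choose n * (p ^ n * (1 - p) ^ (N - n)) = binomialProb N p n := rfl
    _ ≤ 2 * binomialProb v (1 / 2) m := by linarith
    _ ≤ 2 ^ (e + v) * (p ^ n * (1 - p) ^ (N - n)) * binomialProb v (1 / 2) m :=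
        mul_le_mul_of_nonneg_right hw (binomialProb_nonneg (by norm_num) (by norm_num) v m)
    _ = (2 : ℝ) ^ e * v.choose m * (p ^ n * (1 - p) ^ (N - n)) := by
        rw [choose_eq_two_pow_mul_binomialProb_half hm, pow_add]; ring

end Counting

section Asymptotics

open Real Filter

theorem eventually_mul_sqrt_add_le (a b : ℝ) {c : ℝ} (hc : 0 < c) :
    ∀ᶠ N : ℕ in atTop, a * √N + b ≤ N * c := by
  have hsqrt : Tendsto (fun N : ℕ => √(N : ℝ)) atTop atTop :=
    tendsto_sqrt_atTop.comp tendsto_natCast_atTop_atTop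
  have hgap := hsqrt.atTop_mul_atTop₀
    (tendsto_atTop_add_const_right _ (-a) (hsqrt.atTop_mul_const hc))
  filter_upwards [hgap.eventually_ge_atTop b] with N hN
  have hN_sq : √(N : ℝ) * √N = N := mul_self_sqrt N.cast_nonneg
  linear_combination hN + c * hN_sq

/-- A window on which the distributions of Alice's particle number in `N` copies of a qubit state
with occupation probability `p`, and in `v` copies of V-EPR, agree up to a relative error of order
`η`; it lies within distance `r` of the mean of the former. -/
structure IsEPRWindow (p η r : ℝ) (N v n m M : ℕ) : Prop where
  matched : MatchedWindow (binomialProb N p) (binomialProb v (1 / 2)) η n m M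
  left_le : ∀ k < M, n + k ≤ N
  right_le : ∀ k < M, m + k ≤ v
  abs_sub_le : ∀ k < M, |((n + k : ℕ) : ℝ) - N * p| ≤ r

theorem eventually_exists_isEPRWindow {p η : ℝ} (h0 : 0 < p) (h1 : p < 1) (hη0 : 0 < η)
    (hη1 : η ≤ 1) :
    ∀ᶠ N : ℕ in atTop, ∃ n m M,
      IsEPRWindow p η (4 / η * √(p * (1 - p)) * √N) N ⌊N * (4 * (p * (1 - p)))⌋₊ n m M := by
  have hpq : 0 < p * (1 - p) := mul_pos h0 (sub_pos.2 h1)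
  have hsqrt : Tendsto (fun N : ℕ => η ^ 4 * (√(p * (1 - p)) * √(N : ℝ))) atTop atTop :=
    ((tendsto_sqrt_atTop.comp tendsto_natCast_atTop_atTop).const_mul_atTop
      (sqrt_pos.2 hpq)).const_mul_atTop (pow_pos hη0 4)
  filter_upwards [hsqrt.eventually_ge_atTop 1536] with N hN
  have hσ : (√(p * (1 - p)) * √N) ^ 2 = N * p * (1 - p) := by
    rw [mul_pow, sq_sqrt hpq.le, sq_sqrt N.cast_nonneg]
    ring
  have hv : |N * p * (1 - p) - (⌊N * (4 * (p * (1 - p)))⌋₊ : ℝ) * (1 / 2) * (1 - 1 / 2)| ≤ 1 := by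
    have hle : (⌊N * (4 * (p * (1 - p)))⌋₊ : ℝ) ≤ N * (4 * (p * (1 - p))) :=
      Nat.floor_le (by positivity)
    have hlt := Nat.lt_floor_add_one (N * (4 * (p * (1 - p))))
    rw [abs_le]
    constructor <;> linarith
  obtain ⟨n, m, M, hw, hk⟩ := exists_matchedWindow_binomialProb h0 h1 (by norm_num)
    (by norm_num) hσ hv hη0 hη1 hN
  refine ⟨n, m, M, hw, fun k h => (hk k h).1, fun k h => (hk k h).2.1, fun k h => ?_⟩
  rw [mul_assoc]
  exact_mod_cast (hk k h).2.2

namespace IsAnticorrelated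

variable {φ : Ket qubit qubit} {p ε η r : ℝ} {N e v n m M : ℕ}

theorem converts_eprPairs_of_choose_le (h : IsAnticorrelated φ p)
    (hcard : ∀ k < M, 2 ^ e * v.choose (m + k) ≤ N.choose (n + k))
    (hF : 1 - ε ≤ (∑ k ∈ Finset.range M,
      √(binomialProb N p (n + k) * binomialProb v (1 / 2) (m + k))) ^ 2) :
    Converts (φ.pow N) (eprPairs e v) ε := by
  refine (h.blocksPow N).converts_of_blockCard_le (eprBlocks e v) (n := n) (m := m)
    (Z := Finset.range M) (fun k hk => ?_) ?_
  · rw [blockCard_epr, blockCard_finsetCard]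
    exact hcard k (Finset.mem_range.1 hk)
  · simp only [blockCard_epr_mul, blockCard_finsetCard]
    exact hF

theorem converts_pow_of_choose_le (h : IsAnticorrelated φ p)
    (hcard : ∀ k < M, N.choose (n + k) ≤ 2 ^ e * v.choose (m + k))
    (hF : 1 - ε ≤ (∑ k ∈ Finset.range M,
      √(binomialProb N p (n + k) * binomialProb v (1 / 2) (m + k))) ^ 2) :
    Converts (eprPairs e v) (φ.pow N) ε := by
  refine (eprBlocks e v).converts_of_blockCard_le (h.blocksPow N) (n := m) (m := n)
    (Z := Finset.range M) (fun k hk => ?_) ?_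
  · rw [blockCard_epr, blockCard_finsetCard]
    exact hcard k (Finset.mem_range.1 hk)
  · simp only [blockCard_epr_mul, blockCard_finsetCard]
    simpa only [mul_comm, binomialProb] using hF

theorem converts_eprPairs_of_window (h : IsAnticorrelated φ p) (h0 : 0 < p) (h1 : p < 1)
    (hη : η ≤ 1 / 4) (hηε : 4 * η ≤ ε) (hw : IsEPRWindow p η r N v n m M)
    (hev : ((e + v : ℕ) + 1) * log 2 + r * |log p - log (1 - p)| ≤ N * binEntropy p) :
    Converts (φ.pow N) (eprPairs e v) ε := by
  refine h.converts_eprPairs_of_choose_le (fun k hk => ?_)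
    (le_trans (by linarith) (hw.matched.one_sub_le_sq_sum_sqrt (by linarith)))
  have hhalf : 1 / 2 ≤ (1 - η) ^ 2 := by nlinarith
  exact two_pow_mul_choose_le_choose h0 h1 (hw.right_le k hk)
    ((mul_le_mul_of_nonneg_right hhalf (hw.matched.pos k hk).2.le).trans (hw.matched.right_le k hk))
    (two_pow_mul_pow_mul_pow_le h0 h1 (hw.left_le k hk) (hw.abs_sub_le k hk) hev)

theorem converts_pow_of_window (h : IsAnticorrelated φ p) (h0 : 0 < p) (h1 : p < 1)
    (hη : η ≤ 1 / 4) (hηε : 4 * η ≤ ε) (hw : IsEPRWindow p η r N v n m M)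
    (hev : N * binEntropy p + r * |log p - log (1 - p)| + log 2 ≤ (e + v : ℕ) * log 2) :
    Converts (eprPairs e v) (φ.pow N) ε := by
  refine h.converts_pow_of_choose_le (fun k hk => ?_)
    (le_trans (by linarith) (hw.matched.one_sub_le_sq_sum_sqrt (by linarith)))
  have hhalf : 1 / 2 ≤ (1 - η) ^ 2 := by nlinarith
  exact choose_le_two_pow_mul_choose h0 h1 (hw.right_le k hk)
    ((mul_le_mul_of_nonneg_right hhalf (hw.matched.pos k hk).1.le).trans (hw.matched.left_le k hk))
    (two_le_two_pow_mul_pow_mul_pow h0 h1 (hw.left_le k hk) (hw.abs_sub_le k hk) hev)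

theorem eventually_converts_eprPairs (h : IsAnticorrelated φ p) (h0 : 0 < p) (h1 : p < 1)
    (hε : 0 < ε) {c : ℝ} (hc : 0 < c) :
    ∀ᶠ N : ℕ in atTop, ∀ e : ℕ, e ≤ N * (binEntropy p / log 2 - 4 * (p * (1 - p)) - c) →
      Converts (φ.pow N) (eprPairs e ⌊N * (4 * (p * (1 - p)))⌋₊) ε := by
  have hlog : 0 < log 2 := log_pos one_lt_two
  obtain ⟨η, hη0, hη, hηε⟩ : ∃ η : ℝ, 0 < η ∧ η ≤ 1 / 4 ∧ 4 * η ≤ ε :=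
    ⟨min (1 / 4) (ε / 4), by positivity, min_le_left _ _,
      by linarith [min_le_right (1 / 4) (ε / 4)]⟩
  filter_upwards [eventually_exists_isEPRWindow h0 h1 hη0 (by linarith),
    eventually_mul_sqrt_add_le (4 / η * √(p * (1 - p)) * |log p - log (1 - p)|) (log 2)
      (mul_pos hc hlog)] with N ⟨n, m, M, hw⟩ hN e he
  refine h.converts_eprPairs_of_window h0 h1 hη hηε hw ?_
  have hv : (⌊N * (4 * (p * (1 - p)))⌋₊ : ℝ) ≤ N * (4 * (p * (1 - p))) :=
    Nat.floor_le (mul_nonneg N.cast_nonneg (by nlinarith))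
  have hev : ((e + ⌊N * (4 * (p * (1 - p)))⌋₊ : ℕ) : ℝ) * log 2
      ≤ N * binEntropy p - N * (c * log 2) := by
    calc _ ≤ (N * (binEntropy p / log 2 - c)) * log 2 := by
          refine mul_le_mul_of_nonneg_right ?_ hlog.le
          push_cast
          linarith
      _ = _ := by field_simp
  linarith

theorem eventually_converts_pow (h : IsAnticorrelated φ p) (h0 : 0 < p) (h1 : p < 1)
    (hε : 0 < ε) {c : ℝ} (hc : 0 < c) :
    ∀ᶠ N : ℕ in atTop, ∀ e : ℕ, N * (binEntropy p / log 2 - 4 * (p * (1 - p)) + c) ≤ e →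
      Converts (eprPairs e ⌊N * (4 * (p * (1 - p)))⌋₊) (φ.pow N) ε := by
  have hlog : 0 < log 2 := log_pos one_lt_two
  obtain ⟨η, hη0, hη, hηε⟩ : ∃ η : ℝ, 0 < η ∧ η ≤ 1 / 4 ∧ 4 * η ≤ ε :=
    ⟨min (1 / 4) (ε / 4), by positivity, min_le_left _ _,
      by linarith [min_le_right (1 / 4) (ε / 4)]⟩
  filter_upwards [eventually_exists_isEPRWindow h0 h1 hη0 (by linarith),
    eventually_mul_sqrt_add_le (4 / η * √(p * (1 - p)) * |log p - log (1 - p)|) (2 * log 2)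
      (mul_pos hc hlog)] with N ⟨n, m, M, hw⟩ hN e he
  refine h.converts_pow_of_window h0 h1 hη hηε hw ?_
  have hv := Nat.lt_floor_add_one (N * (4 * (p * (1 - p))))
  have hev : N * binEntropy p + N * (c * log 2) - log 2
      ≤ ((e + ⌊N * (4 * (p * (1 - p)))⌋₊ : ℕ) : ℝ) * log 2 := by
    calc _ = (N * (binEntropy p / log 2 + c) - 1) * log 2 := by field_simp
      _ ≤ _ := by
          refine mul_le_mul_of_nonneg_right ?_ hlog.le
          push_cast
          linarith
  linarith

theorem converts_eprPairs_zero_self (h : IsAnticorrelated φ (1 / 2)) (hε : 0 ≤ ε) :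
    Converts (φ.pow N) (eprPairs 0 N) ε := by
  refine h.converts_eprPairs_of_choose_le (n := 0) (m := 0) (M := N + 1) (fun k _ => by simp) ?_
  have hsqrt : ∀ k, √(binomialProb N (1 / 2) k * binomialProb N (1 / 2) k) =
      binomialProb N (1 / 2) k := fun k =>
    sqrt_mul_self (binomialProb_nonneg (by norm_num) (by norm_num) N k)
  simpa only [zero_add, hsqrt, sum_binomialProb, one_pow, sub_le_self_iff] using hε

theorem eventually_converts_eprPairs_floor (h : IsAnticorrelated φ p) (h0 : 0 < p) (h1 : p < 1)
    (hε : 0 < ε) {δ : ℝ} (hδ : 0 < δ) :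
    ∀ᶠ N : ℕ in atTop, Converts (φ.pow N)
      (eprPairs ⌊N * (binEntropy p / log 2 - 4 * (p * (1 - p)) - δ)⌋₊
        ⌊N * (4 * (p * (1 - p)))⌋₊) ε := by
  have hlog : 0 < log 2 := log_pos one_lt_two
  by_cases hp : p = 1 / 2
  · subst hp
    refine Eventually.of_forall fun N => ?_
    have he : ⌊N * (binEntropy (1 / 2) / log 2 - 4 * (1 / 2 * (1 - 1 / 2)) - δ)⌋₊ = 0 := by
      refine Nat.floor_of_nonpos (mul_nonpos_of_nonneg_of_nonpos N.cast_nonneg ?_)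
      rw [one_div, binEntropy_two_inv, div_self hlog.ne']
      linarith
    have hv : ⌊(N : ℝ) * (4 * (1 / 2 * (1 - 1 / 2)))⌋₊ = N := by norm_num
    rw [he, hv]
    exact h.converts_eprPairs_zero_self hε.le
  · have hgap : 0 < binEntropy p / log 2 - 4 * (p * (1 - p)) := by
      rw [sub_pos, lt_div_iff₀ hlog]
      exact four_mul_log_two_mul_lt_binEntropy h0 h1 hp
    filter_upwards [h.eventually_converts_eprPairs h0 h1 hε (lt_min hgap hδ)] with N hN
    refine hN _ (le_trans (Nat.cast_le.2 (Nat.floor_mono ?_)) (Nat.floor_le ?_))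
    · exact mul_le_mul_of_nonneg_left (sub_le_sub_left (min_le_right _ _) _) N.cast_nonneg
    · exact mul_nonneg N.cast_nonneg (sub_nonneg.2 (min_le_left _ _))

end IsAnticorrelated

end Asymptotics

section ProductStates

variable {A B : LocalSystem} {φ : Ket A B} {a₀ : A.ι} {b₀ : B.ι} {ε : ℝ}

theorem blockCard_const_zero (X : Type) : blockCard (fun _ : X => 0) 0 = Nat.card X := by
  simp [blockCard]

theorem converts_eprPairs_zero_zero (hnorm : ‖φ (a₀, b₀)‖ ^ 2 = 1)
    (hsupp : ∀ a b, φ (a, b) ≠ 0 → a = a₀ ∧ b = b₀) (hε : 0 ≤ ε) (N : ℕ) :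
    Converts (φ.pow N) (eprPairs 0 0) ε := by
  refine ((SchmidtBlocks.single hsupp).powFlat N).converts_of_blockCard_le (eprBlocks 0 0)
    (n := 0) (m := 0) (Z := {0}) (fun k hk => ?_) ?_
  · obtain rfl := Finset.mem_singleton.1 hk
    simp [blockCard_epr, blockCard_const_zero]
  · rw [Finset.sum_singleton, blockCard_epr_mul, blockCard_const_zero, hnorm]
    simpa [binomialProb] using hε

theorem converts_pow_of_product (hnorm : ‖φ (a₀, b₀)‖ ^ 2 = 1)
    (hsupp : ∀ a b, φ (a, b) ≠ 0 → a = a₀ ∧ b = b₀) (hε : 0 ≤ ε) (N e : ℕ) :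
    Converts (eprPairs e 0) (φ.pow N) ε := by
  refine (eprBlocks e 0).converts_of_blockCard_le ((SchmidtBlocks.single hsupp).powFlat N)
    (n := 0) (m := 0) (Z := {0}) (fun k hk => ?_) ?_
  · obtain rfl := Finset.mem_singleton.1 hk
    simpa [blockCard_epr, blockCard_const_zero] using Nat.one_le_two_pow
  · rw [Finset.sum_singleton, blockCard_epr_mul, blockCard_const_zero, hnorm]
    simpa [binomialProb] using hε

end ProductStates

namespace IsPureState

open Filter

variable {φ : Ket qubit qubit} {δ ε : ℝ}

theorem siv_le_entanglement (hφ : IsPureState φ) : φ.siv ≤ φ.entanglement := by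
  rw [siv_eq, hφ.entanglement_eq, le_div_iff₀ (Real.log_pos one_lt_two)]
  exact four_mul_log_two_mul_le_binEntropy (marginalA_nonneg φ _) (hφ.marginalA_le_one _)

theorem product_or_isAnticorrelated (hφ : IsPureState φ) :
    (φ.siv = 0 ∧ φ.entanglement = 0 ∧
      ∃ a₀ b₀, ‖φ (a₀, b₀)‖ ^ 2 = 1 ∧ ∀ a b, φ (a, b) ≠ 0 → a = a₀ ∧ b = b₀) ∨
    ∃ p, 0 < p ∧ p < 1 ∧ IsAnticorrelated φ p ∧ φ.siv = 4 * (p * (1 - p)) ∧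
      φ.entanglement = Real.binEntropy p / Real.log 2 := by
  have hE := hφ.entanglement_eq
  have hV := siv_eq φ
  set p := marginalA φ (1 : Fin 2) with hp
  rcases (marginalA_nonneg φ (1 : Fin 2)).eq_or_lt with h0 | h0
  · left
    obtain ⟨b₀, hsupp⟩ := hφ.exists_support_subset_single injective_num_qubit
      (a₀ := (0 : Fin 2)) (by simp [Fin.forall_fin_two, ← h0])
    rw [hV, hE, hp, ← h0]
    exact ⟨by simp, by simp, _, b₀, hφ.norm_sq_eq_one hsupp, hsupp⟩
  rcases (hφ.marginalA_le_one (1 : Fin 2)).eq_or_lt with h1 | h1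
  · left
    obtain ⟨b₀, hsupp⟩ := hφ.exists_support_subset_single injective_num_qubit
      (a₀ := (1 : Fin 2)) (by simp [Fin.forall_fin_two, hφ.marginalA_zero, h1])
    rw [hV, hE, hp, h1]
    exact ⟨by simp, by simp, _, b₀, hφ.norm_sq_eq_one hsupp, hsupp⟩
  · exact Or.inr ⟨p, h0, h1, hφ.isAnticorrelated h0 h1, hV, hE⟩

theorem eventually_converts_eprPairs (hφ : IsPureState φ) (hδ : 0 < δ) (hε : 0 < ε) :
    ∀ᶠ N : ℕ in atTop, Converts (φ.pow N)
      (eprPairs ⌊N * (φ.entanglement - φ.siv - δ)⌋₊ ⌊N * φ.siv⌋₊) ε := by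
  rcases hφ.product_or_isAnticorrelated with
    ⟨hV, hE, a₀, b₀, hnorm, hsupp⟩ | ⟨p, h0, h1, h, hV, hE⟩
  · refine Eventually.of_forall fun N => ?_
    have he : ⌊N * (φ.entanglement - φ.siv - δ)⌋₊ = 0 :=
      Nat.floor_of_nonpos (mul_nonpos_of_nonneg_of_nonpos N.cast_nonneg (by linarith))
    rw [he, hV, mul_zero, Nat.floor_zero]
    exact converts_eprPairs_zero_zero hnorm hsupp hε.le N
  · rw [hV, hE]
    exact h.eventually_converts_eprPairs_floor h0 h1 hε hδ

theorem eventually_converts_pow (hφ : IsPureState φ) (hδ : 0 < δ) (hε : 0 < ε) :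
    ∀ᶠ N : ℕ in atTop, Converts
      (eprPairs ⌈N * (φ.entanglement - φ.siv + δ)⌉₊ ⌊N * φ.siv⌋₊) (φ.pow N) ε := by
  rcases hφ.product_or_isAnticorrelated with
    ⟨hV, -, a₀, b₀, hnorm, hsupp⟩ | ⟨p, h0, h1, h, hV, hE⟩
  · refine Eventually.of_forall fun N => ?_
    rw [hV, mul_zero, Nat.floor_zero]
    exact converts_pow_of_product hnorm hsupp hε.le N _
  · rw [hV, hE]
    filter_upwards [h.eventually_converts_pow h0 h1 hε hδ] with N hN
    exact hN _ (Nat.le_ceil _)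

end IsPureState

end SSR

theorem mainTheorem3 (φ : SSR.Ket SSR.qubit SSR.qubit) (hφ : SSR.IsPureState φ) :
    φ.siv ≤ φ.entanglement ∧
    ∀ δ : ℝ, 0 < δ → ∀ ε : ℝ, 0 < ε → ∃ N₀ : ℕ, ∀ N : ℕ, N₀ ≤ N →
      SSR.Converts (φ.pow N)
        ((SSR.eEPR.pow ⌊(N : ℝ) * (φ.entanglement - φ.siv - δ)⌋₊).tensor
          (SSR.vEPR.pow ⌊(N : ℝ) * φ.siv⌋₊)) ε ∧
      SSR.Converts
        ((SSR.eEPR.pow ⌈(N : ℝ) * (φ.entanglement - φ.siv + δ)⌉₊).tensor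
          (SSR.vEPR.pow ⌊(N : ℝ) * φ.siv⌋₊))
        (φ.pow N) ε := by
  exact ⟨hφ.siv_le_entanglement, fun _ hδ _ hε => Filter.eventually_atTop.1
    ((hφ.eventually_converts_eprPairs hδ hε).and (hφ.eventually_converts_pow hδ hε))⟩
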